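/- Let $p=2$, let $q\ge 2$ be an integer, let $J\in\mathbb Q_2$ with $0<|J|_2<\tfrac12$, and put $\theta=\exp_2(J)$. Let $\Gamma^2=(V,L)$ be the Cayley tree of order two (the tree in which every vertex has exactly three neighbours) with a root $x^0$; let $V_n$ and $W_n$ be the sets of vertices at distance at most $n$, resp. exactly $n$, from $x^0$, and for $\sigma\in\{1,\dots,q\}^{V_n}$ let $H_n(\sigma)=J\sum\delta_{\sigma(x)\sigma(y)}$, summed over the edges $\langle x,y\rangle$ inside $V_n$. A family $h_x=(h_{1,x},\dots,h_{q,x})$, $x\in V$, with $|h_{i,x}|_2<\tfrac12$ defines the $2$-adic Gibbs measure of the $q$-state Potts model, i.e. the finitely additive $\mathbb Q_2$-valued probability measure $\mu$ on the algebra of cylinder subsets of $\{1,\dots,q\}^V$ with $$\mu(\{\sigma : \sigma|_{V_n}=\sigma_n\})=Z_{n,h}^{-1}\exp_2\Big(H_n(\sigma_n)+\sum_{x\in W_n}h_{\sigma_n(x),x}\Big)\qquad(n\ge 1,\ \sigma_n\in\{1,\dots,q\}^{V_n}),$$ where $Z_{n,h}\neq0$ is the normalizing factor, whenever such a measure exists.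 For $1\le m\le[q/2]$, the translation-invariant $2$-adic Gibbs measures (TIpGMs) belonging to $m$ are the Gibbs measures defined by the families $h_x=c\,\mathbf 1_M$ (the same for all $x\in V$), where $M\subset\{1,\dots,q\}$, $|M|=m$ and $c\ne0$. Let $1\le m\le [q/2]$. 1) There exist exactly $2\binom qm$ TIpGMs belonging to $m$ if at least one of the following conditions 1a)–1c) is satisfied and, in addition, $(\theta-1)^3+m(q-m)\,(q-3(\theta-1))\neq0$: 1a) $|4m|_2>\max\{|\theta-1|_2,|q|_2\}$ and $\theta\notin\{1-q,1+q\}$; 1b) $|4m|_2=|\theta-1|_2=|q|_2$ and $\theta\notin\{1-q,1+q\}$; 1c) $|m|_2>|\theta-1|_2=|q|_2>|4m|_2$, $q\ne 2m$, $\theta\notin\{1-q,1+q\}$, and $1-2a+b^2$ is a nonzero square in $\mathbb Q_2$, where $a=\frac q{2m}$, $b=\frac{\theta-1}{2m}$. 2) There exist exactly $\binom qm$ TIpGMs belonging to $m$ if at least one of the following conditions is satisfied: 2a) $|4m|_2>\max\{|\theta-1|_2,|q|_2\}$ and $\theta\in\{1-q,1+q\}$; 2b) $|4m|_2=|\theta-1|_2=|q|_2$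 and $\theta\in\{1-q,1+q\}$; 2c) $|m|_2=|\theta-1|_2=|q|_2>|4m|_2$ and $\theta\notin\{1-q,1+q\}$; 2d) $|m|_2>|\theta-1|_2=|q|_2>|4m|_2$, $q\neq 2m$ and $\theta\in\{1-q,1+q\}$; 2e) $|\theta-1|_2=|q|_2>|m|_2$ and $\theta\notin\{1-q,1+q\}$; 2f) $|m|_2>|\theta-1|_2=|q|_2>|4m|_2$, $q=2m$, $\theta\notin\{1-q,1+q\}$, and $b^2-1$ is a square in $\mathbb Q_2$, where $b=\frac{\theta-1}q$; 2g) $|m|_2>|\theta-1|_2=|q|_2>|4m|_2$, $\theta\notin\{1-q,1+q\}$ and $1-2a+b^2=0$ with $a,b$ as in 1c); 2h) one of 1a), 1b), 1c) holds and $(\theta-1)^3+m(q-m)\,(q-3(\theta-1))=0$. 3) Otherwise (none of 1a)–1c), 2a)–2g) holds) there does not exist any TIpGM belonging to $m$. -/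

import Mathlib

/-- The domain `B(0, p^{-1/(p-1)})` of convergence of the `p`-adic exponential. -/
def expBall (p : ℕ) [Fact p.Prime] : Set ℚ_[p] :=
  {x | ‖x‖ < (p : ℝ) ^ (-(1 : ℝ) / ((p : ℝ) - 1))}

/-- A Cayley tree of order `k` with vertex set `V`: a (connected, acyclic) graph in which every
vertex has exactly `k + 1` neighbours, together with a chosen root. -/
structure CayleyTree (k : ℕ) (V : Type*) where
  graph : SimpleGraph V
  isTree : graph.IsTree
  ncard_neighborSet : ∀ x, (graph.neighborSet x).ncard = k + 1
  root : V

namespace CayleyTree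

variable {k : ℕ} {V : Type*}

theorem finite_ball (T : CayleyTree k V) (n : ℕ) :
    {x | T.graph.dist T.root x ≤ n}.Finite := by
  induction n with
  | zero =>
    refine (Set.finite_singleton T.root).subset fun x hx => ?_
    have h0 : T.graph.dist T.root x = 0 := Nat.le_zero.mp hx
    exact ((T.isTree.connected.dist_eq_zero_iff).mp h0).symm
  | succ n ih =>
    have hfin : ∀ x, (T.graph.neighborSet x).Finite := fun x =>
      Set.finite_of_ncard_ne_zero (by rw [T.ncard_neighborSet x]; omega)
    refine (ih.union (ih.biUnion fun x _ => hfin x)).subset fun x hx => ?_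
    obtain ⟨w, hw⟩ := T.isTree.connected.exists_walk_length_eq_dist x T.root
    cases w with
    | nil => left; simp
    | @cons _ y _ hadj w' =>
      right
      refine Set.mem_biUnion (x := y) ?_ hadj.symm
      have h1 : T.graph.dist y T.root ≤ w'.length := SimpleGraph.dist_le w'
      rw [SimpleGraph.Walk.length_cons, SimpleGraph.dist_comm] at hw
      rw [SimpleGraph.dist_comm] at h1
      have hx' : T.graph.dist T.root x ≤ n + 1 := hx
      change T.graph.dist T.root y ≤ n
      omega

/-- `V_n`, the set of vertices at distance at most `n` from the root. -/
noncomputable def ball (T : CayleyTree k V) (n : ℕ) : Finset V := (T.finite_ball n).toFinset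

/-- The vertices of `V_n` that lie in `W_n`, i.e. at distance exactly `n` from the root. -/
noncomputable def sphere (T : CayleyTree k V) (n : ℕ) : Finset (T.ball n) :=
  Finset.univ.filter fun x => T.graph.dist T.root x = n

end CayleyTree

/-- The algebra of cylinder sets in `Ω = {1, …, q}^V`: the sets of configurations `σ` for which
membership of `σ` depends on the restriction of `σ` to some finite set of vertices only. -/
def cylinderAlgebra (V : Type*) (q : ℕ) : BooleanSubalgebra (Set (V → Fin q)) where
  carrier := {A | ∃ Λ : Finset V, ∀ σ τ : V → Fin q, (∀ x ∈ Λ, σ x = τ x) → (σ ∈ A ↔ τ ∈ A)}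
  supClosed' := by
    classical
    rintro A ⟨Λ, hA⟩ B ⟨Λ', hB⟩
    refine ⟨Λ ∪ Λ', fun σ τ h => ?_⟩
    exact or_congr (hA σ τ fun x hx => h x (Finset.mem_union_left _ hx))
      (hB σ τ fun x hx => h x (Finset.mem_union_right _ hx))
  infClosed' := by
    classical
    rintro A ⟨Λ, hA⟩ B ⟨Λ', hB⟩
    refine ⟨Λ ∪ Λ', fun σ τ h => ?_⟩
    exact and_congr (hA σ τ fun x hx => h x (Finset.mem_union_left _ hx))
      (hB σ τ fun x hx => h x (Finset.mem_union_right _ hx))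
  compl_mem' := by
    rintro A ⟨Λ, hA⟩
    exact ⟨Λ, fun σ τ h => not_congr (hA σ τ h)⟩
  bot_mem' := ⟨∅, fun _ _ _ => Iff.rfl⟩

/-- The cylinder set `{σ ∈ Ω : σ|_Λ = s}` of a configuration `s` on a finite set `Λ`. -/
def cylinderSet {V : Type*} {q : ℕ} (Λ : Finset V) (s : Λ → Fin q) : cylinderAlgebra V q :=
  ⟨{σ | ∀ x : Λ, σ x = s x}, Λ, fun σ τ h =>
    forall_congr' fun x => by rw [h x x.2]⟩

/-- A `p`-adic probability measure on an algebra `𝓑` of subsets of `X`: a finitely additive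
function `𝓑 → ℚ_p` of total mass one. -/
@[ext]
structure PadicProbabilityMeasure (p : ℕ) [Fact p.Prime] {X : Type*}
    (𝓑 : BooleanSubalgebra (Set X)) where
  toFun : 𝓑 → ℚ_[p]
  map_sup_of_disjoint : ∀ A B : 𝓑, Disjoint (A : Set X) (B : Set X) →
    toFun (A ⊔ B) = toFun A + toFun B
  map_top : toFun ⊤ = 1

section Potts

variable {p : ℕ} [Fact p.Prime] {k : ℕ} {V : Type*} {q : ℕ}

open scoped Classical in
/-- The Potts Hamiltonian on `V_n`: `H_n(s) = J ∑ δ_{s(x) s(y)}`, the sum running over the edges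
`⟨x, y⟩` of the tree with both ends in `V_n`. -/
noncomputable def pottsHamiltonian (T : CayleyTree k V) (J : ℚ_[p]) (n : ℕ)
    (s : T.ball n → Fin q) : ℚ_[p] :=
  J * ∑ e : Sym2 (T.ball n),
    if e ∈ (T.graph.induce (T.ball n : Set V)).edgeSet ∧ (e.map s).IsDiag then 1 else 0

/-- The weight `exp_p (H_n(s) + ∑_{x ∈ W_n} h_{s(x), x})`; `h x i` stands for `h_{i, x}`. -/
noncomputable def pottsWeight (T : CayleyTree k V) (J : ℚ_[p]) (h : V → Fin q → ℚ_[p]) (n : ℕ)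
    (s : T.ball n → Fin q) : ℚ_[p] :=
  NormedSpace.exp (pottsHamiltonian T J n s + ∑ x ∈ T.sphere n, h x (s x))

open scoped Classical in
/-- The normalizing factor `Z_{n, h}`. -/
noncomputable def pottsPartition (T : CayleyTree k V) (J : ℚ_[p]) (h : V → Fin q → ℚ_[p])
    (n : ℕ) : ℚ_[p] :=
  ∑ s : T.ball n → Fin q, pottsWeight T J h n s

/-- `μ` is the `p`-adic Gibbs measure of the Potts model with coupling constant `J` that
corresponds to the family of vectors `h x = (h x 1, …, h x q)`: the exponentials and the
finite-dimensional distributions `μ^{(n)}_h = Z_{n,h}⁻¹ exp_p (H_n + ∑_{x ∈ W_n} h_{σ(x), x})`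
make sense for all `n ≥ 1`, and they are the marginals of `μ`. -/
def IsPottsGibbs (T : CayleyTree k V) (J : ℚ_[p]) (h : V → Fin q → ℚ_[p])
    (μ : PadicProbabilityMeasure p (cylinderAlgebra V q)) : Prop :=
  (∀ x i, h x i ∈ expBall p) ∧
    ∀ n : ℕ, 1 ≤ n → pottsPartition T J h n ≠ 0 ∧
      ∀ s : T.ball n → Fin q,
        μ.toFun (cylinderSet (T.ball n) s) = (pottsPartition T J h n)⁻¹ * pottsWeight T J h n s

/-- The translation-invariant `p`-adic Gibbs measures that belong to a given `m`: those given by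
a field `h x = c • 1_M`, the same at every vertex `x`, with `M ⊆ {1, …, q}`, `|M| = m` and
`c ≠ 0` (equivalently `z = exp_p c ≠ 1`). -/
def tiGibbsMeasures (T : CayleyTree k V) (q : ℕ) (J : ℚ_[p]) (m : ℕ) :
    Set (PadicProbabilityMeasure p (cylinderAlgebra V q)) :=
  {μ | ∃ M : Finset (Fin q), M.card = m ∧ ∃ c : ℚ_[p], c ≠ 0 ∧
    IsPottsGibbs T J (fun _ i => if i ∈ M then c else 0) μ}

end Potts

/-- The list of norm conditions of the first kind. -/
def CaseOne (q m : ℕ) (θ : ℚ_[2]) : Prop :=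
  (max ‖θ - 1‖ ‖(q : ℚ_[2])‖ < ‖(4 * m : ℚ_[2])‖ ∧ θ ≠ 1 - q ∧ θ ≠ 1 + q) ∨
  (‖(4 * m : ℚ_[2])‖ = ‖θ - 1‖ ∧ ‖θ - 1‖ = ‖(q : ℚ_[2])‖ ∧ θ ≠ 1 - q ∧ θ ≠ 1 + q) ∨
  (‖θ - 1‖ < ‖(m : ℚ_[2])‖ ∧ ‖θ - 1‖ = ‖(q : ℚ_[2])‖ ∧ ‖(4 * m : ℚ_[2])‖ < ‖(q : ℚ_[2])‖ ∧
    q ≠ 2 * m ∧ θ ≠ 1 - q ∧ θ ≠ 1 + q ∧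
    ∃ s : ℚ_[2], s ≠ 0 ∧ s ^ 2 = 1 - 2 * ((q : ℚ_[2]) / (2 * m)) + ((θ - 1) / (2 * m)) ^ 2)

/-- The list of norm conditions of the second kind. -/
def CaseTwo (q m : ℕ) (θ : ℚ_[2]) : Prop :=
  (max ‖θ - 1‖ ‖(q : ℚ_[2])‖ < ‖(4 * m : ℚ_[2])‖ ∧ (θ = 1 - q ∨ θ = 1 + q)) ∨
  (‖(4 * m : ℚ_[2])‖ = ‖θ - 1‖ ∧ ‖θ - 1‖ = ‖(q : ℚ_[2])‖ ∧ (θ = 1 - q ∨ θ = 1 + q)) ∨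
  (‖(m : ℚ_[2])‖ = ‖θ - 1‖ ∧ ‖θ - 1‖ = ‖(q : ℚ_[2])‖ ∧ ‖(4 * m : ℚ_[2])‖ < ‖(q : ℚ_[2])‖ ∧
    θ ≠ 1 - q ∧ θ ≠ 1 + q) ∨
  (‖θ - 1‖ < ‖(m : ℚ_[2])‖ ∧ ‖θ - 1‖ = ‖(q : ℚ_[2])‖ ∧ ‖(4 * m : ℚ_[2])‖ < ‖(q : ℚ_[2])‖ ∧
    q ≠ 2 * m ∧ (θ = 1 - q ∨ θ = 1 + q)) ∨
  (‖θ - 1‖ = ‖(q : ℚ_[2])‖ ∧ ‖(m : ℚ_[2])‖ < ‖(q : ℚ_[2])‖ ∧ θ ≠ 1 - q ∧ θ ≠ 1 + q) ∨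
  (‖θ - 1‖ < ‖(m : ℚ_[2])‖ ∧ ‖θ - 1‖ = ‖(q : ℚ_[2])‖ ∧ ‖(4 * m : ℚ_[2])‖ < ‖(q : ℚ_[2])‖ ∧
    q = 2 * m ∧ θ ≠ 1 - q ∧ θ ≠ 1 + q ∧ ∃ s : ℚ_[2], s ^ 2 = ((θ - 1) / q) ^ 2 - 1) ∨
  (‖θ - 1‖ < ‖(m : ℚ_[2])‖ ∧ ‖θ - 1‖ = ‖(q : ℚ_[2])‖ ∧ ‖(4 * m : ℚ_[2])‖ < ‖(q : ℚ_[2])‖ ∧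
    θ ≠ 1 - q ∧ θ ≠ 1 + q ∧ 1 - 2 * ((q : ℚ_[2]) / (2 * m)) + ((θ - 1) / (2 * m)) ^ 2 = 0)

/-- The polynomial condition under which, for one of two nontrivial solutions, all normalizing
factors vanish, so that this solution defines no probability measure. -/
def DegeneratePartition (q m : ℕ) (θ : ℚ_[2]) : Prop :=
  (θ - 1) ^ 3 + m * (q - m) * (q - 3 * (θ - 1)) = 0

/-! ### The exponential on `ℚ_[2]` -/

/-! Write d = θ - 1, z = exp c and S = m z + (q - m). Summing the weights over the spins on the
outermost level replaces each boundary factor by a power of the transfer operator, so a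
translation-invariant field h defines a measure exactly when the k-th power of the transfer of exp h
is a nonzero multiple of exp h and the first normalizing factor is nonzero. Later normalizing
factors are then nonzero multiples of it, and finite additivity makes the extension to all cylinders
purely algebraic (`IsPottsGibbs.exists_transfer_pow_eq`, `exists_isPottsGibbs`).

For the field c • 1_M and k = 2 the condition reads z = t² with t = (S + d z) / (S + d). Removing
the factor t - 1, which belongs to c = 0, leaves the quadratic m t² - d t + (q - m) = 0, and the
first normalizing factor is a nonzero multiple of m t³ + (q - m). Conversely, for every 2-adic unit
t the square t² lies in the image of exp, so every t in `nontrivialRoots` yields a field. The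
product of the cubic over both roots of the quadratic vanishes exactly in the degenerate case
(`cubic_mul_cubic`), and two distinct unit roots never both kill it, because X² + X + 1 has no root
modulo 2.

Fields that define the same measure have proportional exponentials (`IsPottsGibbs.exp_mul_exp_eq`).
If 2m < q, distinct pairs (M, t) therefore give distinct measures, and the count is the binomial
coefficient times the number of roots. If q = 2m, the two roots are inverse to each other, and (M,
z) gives the same measure as the complement of M with 1/z; one factor 2 is lost
(`encard_tiGibbsMeasures_of_ne`, `encard_tiGibbsMeasures_of_eq`).

What remains is to count unit roots of the quadratic: by Hensel's lemma after a shift to t = 1 + 2w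
or t = 1 + w, by completing the square in the intermediate norm range, and by hand when d = ± q
makes 1 or -1 a root. `norm_of_unit_root` rules out all other norm ranges. -/

theorem mem_expBall_two {x : ℚ_[2]} : x ∈ expBall 2 ↔ ‖x‖ < 1 / 2 := by
  have : ((2 : ℕ) : ℝ) ^ (-(1 : ℝ) / (((2 : ℕ) : ℝ) - 1)) = 1 / 2 := by
    norm_num [Real.rpow_neg_one]
  rw [expBall, Set.mem_ofPred_eq, this]

/-- The norm takes only 0 and powers of 2 as values, so the open ball of convergence is also a
closed, hence compact, ball. -/
theorem norm_lt_half_iff {x : ℚ_[2]} : ‖x‖ < 1 / 2 ↔ ‖x‖ ≤ 1 / 4 := by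
  have h := Padic.norm_le_pow_iff_norm_lt_pow_add_one x (-2)
  norm_num at h ⊢
  exact h.symm

/-- By Legendre's formula the 2-adic valuation of n! is n minus the binary digit sum, hence at most
n - 1 for n > 0. -/
theorem norm_inv_factorial_le (n : ℕ) : ‖((n.factorial : ℚ_[2]))⁻¹‖ ≤ 2 ^ n / 2 ∨ n = 0 := by
  rcases Nat.eq_zero_or_pos n with h0 | hpos
  · exact Or.inr h0
  left
  have hv : padicValNat 2 n.factorial < n := by
    have := sub_one_mul_padicValNat_factorial_lt_of_ne_zero 2 hpos.ne'
    omega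
  have hne : (n.factorial : ℚ_[2]) ≠ 0 := by exact_mod_cast n.factorial_ne_zero
  rw [norm_inv, Padic.norm_eq_zpow_neg_valuation hne, Padic.valuation_natCast, ← zpow_neg, neg_neg,
    zpow_natCast]
  obtain ⟨k, rfl⟩ : ∃ k, n = k + 1 := ⟨n - 1, by omega⟩
  rw [pow_succ, mul_div_assoc]
  norm_num
  exact pow_le_pow_right₀ (by norm_num) (by omega)

theorem half_le_radius_expSeries :
    ENNReal.ofReal (1 / 2) ≤ (NormedSpace.expSeries ℚ_[2] ℚ_[2]).radius := by
  have : ((1 / 2 : NNReal) : ENNReal) ≤ (NormedSpace.expSeries ℚ_[2] ℚ_[2]).radius := by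
    refine FormalMultilinearSeries.le_radius_of_bound _ 1 fun n => ?_
    rw [NormedSpace.expSeries_eq_ofScalars, FormalMultilinearSeries.ofScalars_norm]
    rcases norm_inv_factorial_le n with h | rfl
    · calc _ ≤ (2 ^ n / 2 : ℝ) * (1 / 2) ^ n := by
            push_cast
            gcongr
        _ = 1 / 2 := by
            rw [div_pow, one_pow]; field_simp
        _ ≤ 1 := by norm_num
    · simp
  convert this using 1
  rw [← ENNReal.ofReal_coe_nnreal]
  norm_num

theorem mem_ball_expSeries {x : ℚ_[2]} (hx : x ∈ expBall 2) :
    x ∈ Metric.eball (0 : ℚ_[2]) (NormedSpace.expSeries ℚ_[2] ℚ_[2]).radius := by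
  rw [mem_expBall_two] at hx
  refine lt_of_lt_of_le ?_ half_le_radius_expSeries
  rw [edist_dist, dist_zero_right]
  exact (ENNReal.ofReal_lt_ofReal_iff (by norm_num)).2 hx

theorem expBall_add {x y : ℚ_[2]} (hx : x ∈ expBall 2) (hy : y ∈ expBall 2) :
    x + y ∈ expBall 2 := by
  rw [mem_expBall_two] at *
  exact lt_of_le_of_lt (Padic.nonarchimedean x y) (max_lt hx hy)

theorem expBall_neg {x : ℚ_[2]} (hx : x ∈ expBall 2) : -x ∈ expBall 2 := by
  rw [mem_expBall_two] at *
  rwa [norm_neg]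

theorem expBall_zero : (0 : ℚ_[2]) ∈ expBall 2 := by
  rw [mem_expBall_two]; norm_num

theorem expBall_sum {ι : Type*} (s : Finset ι) {f : ι → ℚ_[2]} (hf : ∀ i ∈ s, f i ∈ expBall 2) :
    ∑ i ∈ s, f i ∈ expBall 2 := by
  classical
  induction s using Finset.induction_on with
  | empty => simpa using expBall_zero
  | insert a s ha ih =>
    rw [Finset.sum_insert ha]
    exact expBall_add (hf _ (Finset.mem_insert_self _ _))
      (ih fun i hi => hf i (Finset.mem_insert_of_mem hi))

theorem exp_add_of_mem_expBall {x y : ℚ_[2]} (hx : x ∈ expBall 2) (hy : y ∈ expBall 2) :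
    NormedSpace.exp (x + y) = NormedSpace.exp x * NormedSpace.exp y :=
  NormedSpace.exp_add_of_mem_ball (𝕂 := ℚ_[2]) (mem_ball_expSeries hx) (mem_ball_expSeries hy)

theorem exp_sum_of_mem_expBall {ι : Type*} (s : Finset ι) {f : ι → ℚ_[2]}
    (hf : ∀ i ∈ s, f i ∈ expBall 2) :
    NormedSpace.exp (∑ i ∈ s, f i) = ∏ i ∈ s, NormedSpace.exp (f i) := by
  classical
  induction s using Finset.induction_on with
  | empty => simp [NormedSpace.exp_zero]
  | insert a s ha ih =>
    have hs : ∀ i ∈ s, f i ∈ expBall 2 := fun i hi => hf i (Finset.mem_insert_of_mem hi)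
    rw [Finset.sum_insert ha, Finset.prod_insert ha, ← ih hs]
    exact exp_add_of_mem_expBall (hf _ (Finset.mem_insert_self _ _)) (expBall_sum s hs)

theorem norm_exp_sub_one_sub_le {x : ℚ_[2]} (hx : x ∈ expBall 2) :
    ‖NormedSpace.exp x - 1 - x‖ ≤ ‖x‖ / 2 := by
  have hx' := norm_lt_half_iff.1 (mem_expBall_two.1 hx)
  have hs := NormedSpace.expSeries_div_hasSum_exp_of_mem_ball (𝕂 := ℚ_[2]) x (mem_ball_expSeries hx)
  have h2 := (hasSum_nat_add_iff' 2).2 hs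
  have e : NormedSpace.exp x - ∑ i ∈ Finset.range 2, x ^ i / (i.factorial : ℚ_[2])
      = NormedSpace.exp x - 1 - x := by
    simp [Finset.sum_range_succ]; ring
  rw [← e, ← h2.tsum_eq]
  refine IsUltrametricDist.norm_tsum_le_of_forall_le_of_nonneg (by positivity) fun n => ?_
  rw [div_eq_mul_inv, norm_mul, norm_pow]
  have h3 := (norm_inv_factorial_le (n + 2)).resolve_right (by omega)
  -- Each term of degree at least 2 is bounded separately; 2‖x‖ ≤ 1/2 absorbs the growth of the
  -- inverse factorials.
  calc ‖x‖ ^ (n + 2) * ‖((n + 2).factorial : ℚ_[2])⁻¹‖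
      ≤ ‖x‖ ^ (n + 2) * (2 ^ (n + 2) / 2) := by gcongr
    _ = ‖x‖ * (2 * ‖x‖) ^ (n + 1) := by ring
    _ ≤ ‖x‖ * (1 / 2) ^ (n + 1) := by
        gcongr
        linarith
    _ ≤ ‖x‖ * (1 / 2) := by
        gcongr
        rw [pow_succ]
        have : (1 / 2 : ℝ) ^ n ≤ 1 := pow_le_one₀ (by norm_num) (by norm_num)
        linarith
    _ = ‖x‖ / 2 := by ring

theorem norm_exp_sub_one {x : ℚ_[2]} (hx : x ∈ expBall 2) : ‖NormedSpace.exp x - 1‖ = ‖x‖ := by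
  rcases eq_or_ne x 0 with rfl | h0
  · simp [NormedSpace.exp_zero]
  have h := norm_exp_sub_one_sub_le hx
  have hpos : 0 < ‖x‖ := norm_pos_iff.2 h0
  have e : NormedSpace.exp x - 1 = (NormedSpace.exp x - 1 - x) + x := by ring
  rw [e, Padic.add_eq_max_of_ne (by linarith), max_eq_right (by linarith)]

theorem norm_exp {x : ℚ_[2]} (hx : x ∈ expBall 2) : ‖NormedSpace.exp x‖ = 1 := by
  have h := norm_exp_sub_one hx
  rw [mem_expBall_two] at hx
  have e : NormedSpace.exp x = (NormedSpace.exp x - 1) + 1 := by ring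
  rw [e, Padic.add_eq_max_of_ne (by rw [h, norm_one]; linarith), norm_one,
    max_eq_right (by rw [h]; linarith)]

theorem norm_exp_sub_exp {x y : ℚ_[2]} (hx : x ∈ expBall 2) (hy : y ∈ expBall 2) :
    ‖NormedSpace.exp x - NormedSpace.exp y‖ = ‖x - y‖ := by
  have hxy : x - y ∈ expBall 2 := by
    rw [sub_eq_add_neg]; exact expBall_add hx (expBall_neg hy)
  have e : NormedSpace.exp x - NormedSpace.exp y
      = NormedSpace.exp y * (NormedSpace.exp (x - y) - 1) := by
    rw [mul_sub, ← exp_add_of_mem_expBall hy hxy]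
    simp
  rw [e, norm_mul, norm_exp hy, norm_exp_sub_one hxy, one_mul]

theorem exp_injOn_expBall : Set.InjOn NormedSpace.exp (expBall 2) := by
  intro x hx y hy h
  have := norm_exp_sub_exp hx hy
  rw [h, sub_self, norm_zero] at this
  exact sub_eq_zero.1 (norm_eq_zero.1 this.symm)

/-- A minimizer x of ‖y - exp x‖ exists by compactness. The Newton correction e = (y - exp x) / exp
x leaves the error -exp x (exp e - 1 - e), at most half of the old one, so the minimum must be 0. -/
theorem exists_exp_eq {y : ℚ_[2]} (hy : ‖y - 1‖ < 1 / 2) :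
    ∃ x ∈ expBall 2, NormedSpace.exp x = y := by
  have hB : ∀ x : ℚ_[2], x ∈ Metric.closedBall (0 : ℚ_[2]) (1 / 4) ↔ x ∈ expBall 2 := fun x => by
    rw [mem_closedBall_zero_iff, mem_expBall_two, norm_lt_half_iff]
  have hcont : ContinuousOn (fun x : ℚ_[2] => ‖y - NormedSpace.exp x‖)
      (Metric.closedBall 0 (1 / 4)) := by
    refine (continuousOn_const.sub ?_).norm
    refine (LipschitzOnWith.of_dist_le_mul (K := 1) fun x hx z hz => ?_).continuousOn
    rw [dist_eq_norm, dist_eq_norm, norm_exp_sub_exp ((hB x).1 hx) ((hB z).1 hz)]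
    simp
  obtain ⟨x, hx, hmin⟩ := (isCompact_closedBall (0 : ℚ_[2]) (1 / 4)).exists_isMinOn
    ⟨0, by simp⟩ hcont
  have hxB := (hB x).1 hx
  refine ⟨x, hxB, ?_⟩
  by_contra hne
  have hex := norm_exp hxB
  have hex0 : NormedSpace.exp x ≠ 0 := fun h => by rw [h, norm_zero] at hex; norm_num at hex
  set e : ℚ_[2] := (y - NormedSpace.exp x) / NormedSpace.exp x with he
  have hne' : ‖y - NormedSpace.exp x‖ = ‖e‖ := by rw [he, norm_div, hex, div_one]
  have heB : e ∈ expBall 2 := by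
    rw [mem_expBall_two, ← hne']
    have : y - NormedSpace.exp x = (y - 1) + -(NormedSpace.exp x - 1) := by ring
    rw [this]
    refine lt_of_le_of_lt (Padic.nonarchimedean _ _) (max_lt hy ?_)
    rw [norm_neg, norm_exp_sub_one hxB]
    exact mem_expBall_two.1 hxB
  have hle := hmin ((hB _).2 (expBall_add hxB heB))
  simp only [Set.mem_ofPred_eq] at hle
  have e2 : y - NormedSpace.exp (x + e)
      = -(NormedSpace.exp x * (NormedSpace.exp e - 1 - e)) := by
    rw [exp_add_of_mem_expBall hxB heB, he]
    field_simp
    ring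
  rw [hne', e2, norm_neg, norm_mul, hex, one_mul] at hle
  have h3 := norm_exp_sub_one_sub_le heB
  have h4 : ‖e‖ = 0 := by linarith [norm_nonneg e]
  rw [h4] at hne'
  exact hne (sub_eq_zero.1 (norm_eq_zero.1 hne')).symm

/-! ### Finitely additive measures on the algebra of cylinder sets -/

section CylinderMeasure

variable {p : ℕ} [Fact p.Prime] {V : Type*} {q : ℕ}

/-- Extension of a configuration on a finite set of vertices to a configuration on `V`. -/
noncomputable def extendConfig [NeZero q] {Λ : Finset V} (s : Λ → Fin q) : V → Fin q :=
  open scoped Classical in fun x => if h : x ∈ Λ then s ⟨x, h⟩ else 0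

theorem extendConfig_of_mem [NeZero q] {Λ : Finset V} (s : Λ → Fin q) {x : V} (hx : x ∈ Λ) :
    extendConfig s x = s ⟨x, hx⟩ := by
  simp [extendConfig, hx]

@[simp]
theorem extendConfig_coe [NeZero q] {Λ : Finset V} (s : Λ → Fin q) (x : Λ) :
    extendConfig s x = s x :=
  extendConfig_of_mem s x.2

namespace PadicProbabilityMeasure

variable {X : Type*} {𝓑 : BooleanSubalgebra (Set X)} (μ : PadicProbabilityMeasure p 𝓑)

theorem toFun_bot : μ.toFun ⊥ = 0 := by
  have h := μ.map_sup_of_disjoint ⊥ ⊥ (by simp)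
  rw [bot_sup_eq] at h
  simpa using h

theorem toFun_finset_sup {ι : Type*} (S : Finset ι) (A : ι → 𝓑)
    (hA : ∀ i ∈ S, ∀ j ∈ S, i ≠ j → Disjoint (A i : Set X) (A j : Set X)) :
    μ.toFun (S.sup A) = ∑ i ∈ S, μ.toFun (A i) := by
  classical
  induction S using Finset.induction_on with
  | empty => simpa using μ.toFun_bot
  | insert a S ha ih =>
    rw [Finset.sup_insert, Finset.sum_insert ha, μ.map_sup_of_disjoint, ih]
    · exact fun i hi j hj => hA i (Finset.mem_insert_of_mem hi) j (Finset.mem_insert_of_mem hj)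
    · have : ((S.sup A : 𝓑) : Set X) = S.sup fun i => (A i : Set X) := by
        clear ih hA ha
        induction S using Finset.induction_on with
        | empty => simp
        | insert b S hb ih => simp [ih]
      rw [this, Finset.disjoint_sup_right]
      intro i hi
      exact hA _ (Finset.mem_insert_self _ _) _ (Finset.mem_insert_of_mem hi)
        (fun h => ha (h ▸ hi))

end PadicProbabilityMeasure

theorem disjoint_cylinderSet {Λ : Finset V} {s t : Λ → Fin q} (h : s ≠ t) :
    Disjoint (cylinderSet Λ s : Set (V → Fin q)) (cylinderSet Λ t : Set (V → Fin q)) := by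
  rw [Set.disjoint_left]
  intro σ hs ht
  exact h (funext fun x => (hs x).symm.trans (ht x))

theorem coe_finset_sup_cylinderAlgebra {ι : Type*} (S : Finset ι) (A : ι → cylinderAlgebra V q)
    (σ : V → Fin q) :
    σ ∈ ((S.sup A : cylinderAlgebra V q) : Set (V → Fin q)) ↔
      ∃ i ∈ S, σ ∈ (A i : Set (V → Fin q)) := by
  classical
  induction S using Finset.induction_on with
  | empty => simp
  | insert b S hb ih => simp [ih]

-- An event depending only on the spins in Λ is the disjoint union of the atoms over Λ it contains;
-- membership of an atom is tested on the padded configuration.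
open scoped Classical in
theorem toFun_eq_sum_cylinderSet [NeZero q] (μ : PadicProbabilityMeasure p (cylinderAlgebra V q))
    (A : cylinderAlgebra V q) (Λ : Finset V)
    (hA : ∀ σ τ : V → Fin q, (∀ x ∈ Λ, σ x = τ x) →
      (σ ∈ (A : Set (V → Fin q)) ↔ τ ∈ (A : Set (V → Fin q)))) :
    μ.toFun A = ∑ s : Λ → Fin q with extendConfig s ∈ (A : Set (V → Fin q)),
      μ.toFun (cylinderSet Λ s) := by
  rw [← μ.toFun_finset_sup _ _ fun i _ j _ hij => disjoint_cylinderSet hij]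
  congr 1
  ext σ
  rw [coe_finset_sup_cylinderAlgebra]
  constructor
  · intro hσ
    refine ⟨fun x => σ x, ?_, fun x => rfl⟩
    simp only [Finset.mem_filter, Finset.mem_univ, true_and]
    exact (hA _ _ fun x hx => extendConfig_of_mem _ hx).2 hσ
  · rintro ⟨s, hs, hσ⟩
    simp only [Finset.mem_filter, Finset.mem_univ, true_and] at hs
    exact (hA _ _ fun x hx => (extendConfig_of_mem s hx).trans (hσ ⟨x, hx⟩).symm).1 hs

theorem cylinderMeasure_ext [NeZero q] {B : ℕ → Finset V} (hB : ∀ Λ : Finset V, ∃ n, Λ ⊆ B n)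
    {μ ν : PadicProbabilityMeasure p (cylinderAlgebra V q)}
    (h : ∀ n s, μ.toFun (cylinderSet (B n) s) = ν.toFun (cylinderSet (B n) s)) : μ = ν := by
  ext A
  obtain ⟨Λ, hΛ⟩ := A.2
  obtain ⟨n, hn⟩ := hB Λ
  have hA : ∀ σ τ : V → Fin q, (∀ x ∈ B n, σ x = τ x) →
      (σ ∈ (A : Set (V → Fin q)) ↔ τ ∈ (A : Set (V → Fin q))) :=
    fun σ τ hst => hΛ σ τ fun x hx => hst x (hn hx)
  rw [toFun_eq_sum_cylinderSet μ A _ hA, toFun_eq_sum_cylinderSet ν A _ hA]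
  exact Finset.sum_congr rfl fun s _ => h n s

open scoped Classical in
theorem toFun_cylinderSet_eq_sum [NeZero q] {Λ Λ' : Finset V} (hΛ : Λ ⊆ Λ')
    (μ : PadicProbabilityMeasure p (cylinderAlgebra V q)) (s : Λ → Fin q) :
    μ.toFun (cylinderSet Λ s) =
      ∑ t : Λ' → Fin q with Finset.restrict₂ (π := fun _ => Fin q) hΛ t = s,
        μ.toFun (cylinderSet Λ' t) := by
  classical
  rw [toFun_eq_sum_cylinderSet μ (cylinderSet Λ s) Λ' fun σ τ hst =>
    forall_congr' fun x => by rw [hst x (hΛ x.2)]]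
  refine Finset.sum_congr (Finset.filter_congr fun t _ => ?_) fun _ _ => rfl
  constructor
  · intro h
    funext x
    rw [← h x]
    exact (extendConfig_of_mem t (hΛ x.2)).symm
  · rintro rfl x
    exact extendConfig_of_mem t (hΛ x.2)

open scoped Classical in
/-- Kolmogorov's extension theorem for finitely additive measures on cylinder sets. -/
theorem exists_measure_of_consistent [NeZero q] {B : ℕ → Finset V}
    (hB : ∀ Λ : Finset V, ∃ n, Λ ⊆ B n) (hmono : ∀ n, B n ⊆ B (n + 1))
    (f : ∀ n, (B n → Fin q) → ℚ_[p]) (h0 : ∑ s, f 0 s = 1)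
    (hf : ∀ n s, ∑ t : B (n + 1) → Fin q with
      Finset.restrict₂ (π := fun _ => Fin q) (hmono n) t = s, f (n + 1) t = f n s) :
    ∃ μ : PadicProbabilityMeasure p (cylinderAlgebra V q),
      ∀ n s, μ.toFun (cylinderSet (B n) s) = f n s := by
  classical
  have hmono' : Monotone B := monotone_nat_of_le_succ hmono
  -- `g A n` is the mass of A computed at level n and `D A n` says that the spins in `B n` decide A.
  -- Consistency makes `g A` constant from the first such n on, and this constant is the measure of
  -- A.
  let g (A : Set (V → Fin q)) (n : ℕ) : ℚ_[p] := ∑ s with extendConfig s ∈ A, f n s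
  let D (A : Set (V → Fin q)) (n : ℕ) : Prop :=
    ∀ σ τ : V → Fin q, (∀ x ∈ B n, σ x = τ x) → (σ ∈ A ↔ τ ∈ A)
  have hD_mono (A) {n m : ℕ} (hnm : n ≤ m) (h : D A n) : D A m :=
    fun σ τ hst => h σ τ fun x hx => hst x (hmono' hnm hx)
  have hD_ex (A : cylinderAlgebra V q) : ∃ n, D A n := by
    obtain ⟨Λ, hΛ⟩ := A.2
    obtain ⟨n, hn⟩ := hB Λ
    exact ⟨n, fun σ τ hst => hΛ σ τ fun x hx => hst x (hn hx)⟩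
  have hstep (A) (n : ℕ) (h : D A n) : g A (n + 1) = g A n := by
    simp only [g]
    rw [← Finset.sum_fiberwise_of_maps_to (t := Finset.univ.filter fun s => extendConfig s ∈ A)
      (g := Finset.restrict₂ (π := fun _ => Fin q) (hmono n))]
    · refine Finset.sum_congr rfl fun s hs => ?_
      rw [← hf n s, Finset.filter_filter]
      refine Finset.sum_congr (Finset.filter_congr fun t _ => ?_) fun _ _ => rfl
      simp only [Finset.mem_filter, Finset.mem_univ, true_and] at hs
      refine ⟨fun h => h.2, fun ht => ⟨?_, ht⟩⟩
      subst ht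
      refine (h _ _ fun x hx => ?_).1 hs
      rw [extendConfig_of_mem _ hx, extendConfig_of_mem _ (hmono n hx)]
      rfl
    · intro t ht
      simp only [Finset.mem_filter, Finset.mem_univ, true_and] at ht ⊢
      refine (h _ _ fun x hx => ?_).1 ht
      rw [extendConfig_of_mem _ hx, extendConfig_of_mem _ (hmono n hx)]
      rfl
  have hstable (A) (n m : ℕ) (hnm : n ≤ m) (h : D A n) : g A m = g A n := by
    induction m, hnm using Nat.le_induction with
    | base => rfl
    | succ m hm ih => rw [hstep A m (hD_mono A hm h), ih]
  choose N hN using hD_ex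
  have hval (A : cylinderAlgebra V q) (n : ℕ) (h : D A n) : g A (N A) = g A n := by
    rw [← hstable A (N A) (max (N A) n) (le_max_left _ _) (hN A),
      ← hstable A n (max (N A) n) (le_max_right _ _) h]
  refine ⟨⟨fun A => g A (N A), fun A A' hAA' => ?_, ?_⟩, fun n s => ?_⟩
  · have hm1 := hD_mono _ (le_max_left (N A) (N A')) (hN A)
    have hm2 := hD_mono _ (le_max_right (N A) (N A')) (hN A')
    rw [hval A _ hm1, hval A' _ hm2, hval (A ⊔ A') (max (N A) (N A'))
      fun σ τ hst => or_congr (hm1 σ τ hst) (hm2 σ τ hst)]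
    simp only [g]
    rw [← Finset.sum_union]
    · rw [← Finset.filter_or]
      exact Finset.sum_congr (Finset.filter_congr fun _ _ => Iff.rfl) fun _ _ => rfl
    · rw [Finset.disjoint_filter]
      exact fun s _ h1 h2 => Set.disjoint_left.1 hAA' h1 h2
  · rw [hval ⊤ 0 fun _ _ _ => Iff.rfl, ← h0]
    refine Finset.sum_congr (Finset.filter_true_of_mem fun _ _ => trivial) fun _ _ => rfl
  · change g _ (N (cylinderSet (B n) s)) = f n s
    have hD : D (cylinderSet (B n) s) n := fun σ τ hst => by
      change (∀ x : B n, σ x = s x) ↔ ∀ x : B n, τ x = s x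
      exact forall_congr' fun x => by rw [hst x x.2]
    rw [hval _ n hD]
    have : (Finset.univ.filter fun t : B n → Fin q =>
        extendConfig t ∈ (cylinderSet (B n) s : Set (V → Fin q))) = {s} := by
      ext t
      simp only [Finset.mem_filter, Finset.mem_univ, true_and, Finset.mem_singleton]
      constructor
      · intro h
        funext x
        rw [← h x, extendConfig_coe]
      · rintro rfl x
        exact extendConfig_coe _ _
    simp only [g]
    rw [this, Finset.sum_singleton]

end CylinderMeasure

/-! ### Balls, spheres and parents in a Cayley tree -/

namespace CayleyTree

variable {k : ℕ} {V : Type*} (T : CayleyTree k V)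

theorem mem_ball {n : ℕ} {x : V} : x ∈ T.ball n ↔ T.graph.dist T.root x ≤ n := by
  simp [ball]

theorem ball_subset_succ (n : ℕ) : T.ball n ⊆ T.ball (n + 1) := fun x hx => by
  rw [mem_ball] at *
  omega

theorem exists_subset_ball (Λ : Finset V) : ∃ n, Λ ⊆ T.ball (n + 1) :=
  ⟨Λ.sup fun x => T.graph.dist T.root x, fun x hx => by
    have := Finset.le_sup (f := fun x => T.graph.dist T.root x) hx
    rw [mem_ball]
    omega⟩

theorem exists_adj_dist_add_one {y : V} (hy : y ≠ T.root) :
    ∃ x, T.graph.Adj x y ∧ T.graph.dist T.root x + 1 = T.graph.dist T.root y := by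
  obtain ⟨w, hw⟩ := T.isTree.connected.exists_walk_length_eq_dist y T.root
  cases w with
  | nil => exact absurd rfl hy
  | @cons _ x _ hadj w' =>
    refine ⟨x, hadj.symm, ?_⟩
    have h1 : T.graph.dist x T.root ≤ w'.length := SimpleGraph.dist_le w'
    rw [SimpleGraph.Walk.length_cons, SimpleGraph.dist_comm] at hw
    rw [SimpleGraph.dist_comm] at h1
    rcases T.isTree.dist_eq_dist_add_one_of_adj T.root hadj with h | h <;> omega

/-- Geodesics to x and x', prolonged to y, are two paths from the root to y. They coincide in a
tree, and so do their penultimate vertices. -/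
theorem eq_of_adj_of_dist_add_one {x x' y : V} (hx : T.graph.Adj x y) (hx' : T.graph.Adj x' y)
    (hd : T.graph.dist T.root x + 1 = T.graph.dist T.root y)
    (hd' : T.graph.dist T.root x' + 1 = T.graph.dist T.root y) : x = x' := by
  obtain ⟨w, hw⟩ := T.isTree.connected.exists_walk_length_eq_dist T.root x
  obtain ⟨w', hw'⟩ := T.isTree.connected.exists_walk_length_eq_dist T.root x'
  have h1 : (w.concat hx).IsPath := SimpleGraph.Walk.isPath_of_length_eq_dist _ (by
    rw [SimpleGraph.Walk.length_concat, hw, hd])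
  have h2 : (w'.concat hx').IsPath := SimpleGraph.Walk.isPath_of_length_eq_dist _ (by
    rw [SimpleGraph.Walk.length_concat, hw', hd'])
  have h := (T.isTree.existsUnique_path _ _).unique h1 h2
  have := congrArg SimpleGraph.Walk.penultimate h
  simpa using this

open scoped Classical in
/-- The neighbour of `y` on the path to the root (and the root itself if `y` is the root). -/
noncomputable def parent (y : V) : V :=
  if h : y = T.root then T.root else (T.exists_adj_dist_add_one h).choose

theorem adj_parent {y : V} (hy : y ≠ T.root) : T.graph.Adj (T.parent y) y := by
  rw [parent, dif_neg hy]
  exact (T.exists_adj_dist_add_one hy).choose_spec.1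

theorem dist_parent {y : V} (hy : y ≠ T.root) :
    T.graph.dist T.root (T.parent y) + 1 = T.graph.dist T.root y := by
  rw [parent, dif_neg hy]
  exact (T.exists_adj_dist_add_one hy).choose_spec.2

theorem parent_eq {x y : V} (h : T.graph.Adj x y)
    (hd : T.graph.dist T.root x + 1 = T.graph.dist T.root y) : T.parent y = x := by
  have hy : y ≠ T.root := by rintro rfl; simp at hd
  exact T.eq_of_adj_of_dist_add_one (T.adj_parent hy) h (T.dist_parent hy) hd

theorem parent_mem_ball {n : ℕ} {y : V} (hy : y ∈ T.ball n) : T.parent y ∈ T.ball n := by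
  by_cases h : y = T.root
  · subst h; simpa [parent] using hy
  · have := T.dist_parent h
    rw [mem_ball] at *
    omega

/-- The vertices at distance exactly `n` from the root, as a finite set of vertices. -/
noncomputable def level (n : ℕ) : Finset V :=
  (T.ball n).filter fun x => T.graph.dist T.root x = n

theorem mem_level {n : ℕ} {x : V} : x ∈ T.level n ↔ T.graph.dist T.root x = n := by
  rw [level, Finset.mem_filter, mem_ball]
  omega

theorem level_subset_ball (n : ℕ) : T.level n ⊆ T.ball n := Finset.filter_subset _ _

theorem ne_root_of_mem_level {n : ℕ} {x : V} (hx : x ∈ T.level (n + 1)) : x ≠ T.root := by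
  rintro rfl
  rw [mem_level, SimpleGraph.dist_self] at hx
  omega

theorem parent_mem_level {n : ℕ} {y : V} (hy : y ∈ T.level (n + 1)) : T.parent y ∈ T.level n := by
  have := T.dist_parent (T.ne_root_of_mem_level hy)
  rw [mem_level] at *
  omega

theorem level_zero : T.level 0 = {T.root} := by
  ext x
  rw [mem_level, Finset.mem_singleton, T.isTree.connected.dist_eq_zero_iff, eq_comm]

theorem ball_zero : T.ball 0 = {T.root} := by
  ext x
  rw [mem_ball, Nat.le_zero, Finset.mem_singleton, T.isTree.connected.dist_eq_zero_iff, eq_comm]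

theorem disjoint_ball_level (n : ℕ) : Disjoint (T.ball n) (T.level (n + 1)) := by
  rw [Finset.disjoint_left]
  intro x hx hx'
  rw [mem_ball] at hx
  rw [mem_level] at hx'
  omega

open scoped Classical in
theorem ball_succ (n : ℕ) : T.ball (n + 1) = T.ball n ∪ T.level (n + 1) := by
  ext x
  rw [Finset.mem_union, mem_ball, mem_ball, mem_level]
  omega

open scoped Classical in
theorem coe_children_root :
    ((T.level 1).filter fun y => T.parent y = T.root : Finset V) =
      (T.graph.neighborSet T.root : Set V) := by
  ext y
  simp only [Finset.coe_filter, mem_level, Set.mem_ofPred_eq, SimpleGraph.mem_neighborSet]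
  constructor
  · rintro ⟨h1, h2⟩
    have hy : y ≠ T.root := by rintro rfl; simp at h1
    exact h2 ▸ T.adj_parent hy
  · intro h
    have h1 : T.graph.dist T.root y = 1 := SimpleGraph.dist_eq_one_iff_adj.2 h
    exact ⟨h1, T.parent_eq h (by rw [h1, SimpleGraph.dist_self])⟩

open scoped Classical in
theorem coe_children {n : ℕ} {x : V} (hx : x ∈ T.level (n + 1)) :
    ((T.level (n + 2)).filter fun y => T.parent y = x : Finset V) =
      (T.graph.neighborSet x : Set V) \ {T.parent x} := by
  have hxr := T.ne_root_of_mem_level hx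
  rw [mem_level] at hx
  ext y
  simp only [Finset.coe_filter, mem_level, Set.mem_ofPred_eq, SimpleGraph.mem_neighborSet,
    Set.mem_sdiff, Set.mem_singleton_iff]
  constructor
  · rintro ⟨h1, h2⟩
    have hy : y ≠ T.root := by rintro rfl; simp at h1
    refine ⟨h2 ▸ T.adj_parent hy, ?_⟩
    rintro rfl
    have := T.dist_parent hxr
    omega
  · rintro ⟨h, hne⟩
    rcases T.isTree.dist_eq_dist_add_one_of_adj T.root h with h1 | h1
    · exact absurd (T.parent_eq h.symm h1.symm).symm hne
    · exact ⟨by omega, T.parent_eq h h1.symm⟩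

open scoped Classical in
theorem card_children_root : ((T.level 1).filter fun y => T.parent y = T.root).card = k + 1 := by
  rw [← Set.ncard_coe_finset, coe_children_root, T.ncard_neighborSet]

open scoped Classical in
theorem card_children {n : ℕ} {x : V} (hx : x ∈ T.level (n + 1)) :
    ((T.level (n + 2)).filter fun y => T.parent y = x).card = k := by
  rw [← Set.ncard_coe_finset, T.coe_children hx,
    Set.ncard_sdiff_singleton_of_mem
      ((T.graph.mem_neighborSet _ _).2 (T.adj_parent (T.ne_root_of_mem_level hx)).symm),
    T.ncard_neighborSet, Nat.add_sub_cancel]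

theorem level_one_nonempty : (T.level 1).Nonempty := by
  classical
  have h := T.card_children_root
  have : 0 < ((T.level 1).filter fun y => T.parent y = T.root).card := by omega
  exact (Finset.card_pos.1 this).mono (Finset.filter_subset _ _)

open scoped Classical in
/-- The edges of the tree inside a ball are the pairs of a vertex other than the root and its
parent. -/
theorem sum_edges_ball {q n : ℕ} [NeZero q] {K : Type*} [AddCommMonoidWithOne K]
    (s : T.ball n → Fin q) :
    (∑ e : Sym2 (T.ball n),
      if e ∈ (T.graph.induce (T.ball n : Set V)).edgeSet ∧ (e.map s).IsDiag then (1 : K) else 0) =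
    ∑ y ∈ T.ball n,
      if y ≠ T.root ∧ extendConfig s y = extendConfig s (T.parent y) then 1 else 0 := by
  rw [← Finset.sum_filter, ← Finset.sum_filter]
  symm
  refine Finset.sum_bij (fun y hy => s(⟨T.parent y, T.parent_mem_ball
    (Finset.mem_filter.1 hy).1⟩,
    ⟨y, (Finset.mem_filter.1 hy).1⟩)) ?_ ?_ ?_ fun _ _ => rfl
  · intro y hy
    simp only [Finset.mem_filter] at hy
    obtain ⟨hyb, hy0, hys⟩ := hy
    simp only [Finset.mem_filter, Finset.mem_univ, true_and, SimpleGraph.mem_edgeSet,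
      SimpleGraph.comap_adj, Sym2.map_mk, Sym2.mk_isDiag_iff]
    refine ⟨T.adj_parent hy0, ?_⟩
    rw [extendConfig_of_mem s hyb, extendConfig_of_mem s (T.parent_mem_ball hyb)] at hys
    exact hys.symm
  · intro y hy z hz h
    simp only [Finset.mem_filter] at hy hz
    have h1 := T.dist_parent hy.2.1
    have h2 := T.dist_parent hz.2.1
    simp only [Sym2.eq_iff, Subtype.mk.injEq] at h
    -- In the second alternative y and z would be parents of each other, against the distances to
    -- the root.
    rcases h with h | ⟨h, h'⟩
    · exact h.2
    · rw [h] at h1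
      rw [← h'] at h2
      omega
  · intro e he
    induction e using Sym2.ind with
    | _ a b =>
    simp only [Finset.mem_filter, Finset.mem_univ, true_and, SimpleGraph.mem_edgeSet,
      SimpleGraph.comap_adj, Sym2.map_mk, Sym2.mk_isDiag_iff] at he
    obtain ⟨hadj, hs⟩ := he
    have hadj' : T.graph.Adj a b := hadj
    rcases T.isTree.dist_eq_dist_add_one_of_adj T.root hadj' with h | h
    · have hp := T.parent_eq hadj'.symm h.symm
      refine ⟨a, ?_, ?_⟩
      · simp only [Finset.mem_filter]
        refine ⟨a.2, ?_, ?_⟩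
        · intro h0; rw [h0, SimpleGraph.dist_self] at h; omega
        · rw [hp, extendConfig_coe, extendConfig_coe, hs]
      · rw [Sym2.eq_iff]
        exact Or.inr ⟨Subtype.ext hp, rfl⟩
    · have hp := T.parent_eq hadj' h.symm
      refine ⟨b, ?_, ?_⟩
      · simp only [Finset.mem_filter]
        refine ⟨b.2, ?_, ?_⟩
        · intro h0; rw [h0, SimpleGraph.dist_self] at h; omega
        · rw [hp, extendConfig_coe, extendConfig_coe, hs]
      · rw [Sym2.eq_iff]
        exact Or.inl ⟨Subtype.ext hp, rfl⟩

end CayleyTree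

/-! ### Boltzmann weights for a translation-invariant field -/

section Weights

variable {k : ℕ} {V : Type*} {q : ℕ}

open scoped Classical in
/-- The product of the Boltzmann factors of the edges joining vertices of `Λ` to their parents. -/
noncomputable def edgeWeight (T : CayleyTree k V) (θ : ℚ_[2]) (Λ : Finset V) (σ : V → Fin q) :
    ℚ_[2] :=
  ∏ y ∈ Λ, if y ≠ T.root ∧ σ y = σ (T.parent y) then θ else 1

/-- One step of the Potts transfer operator applied to the vector `ζ`. -/
noncomputable def transfer (θ : ℚ_[2]) (ζ : Fin q → ℚ_[2]) (i : Fin q) : ℚ_[2] :=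
  ∑ j, (if j = i then θ else 1) * ζ j

theorem edgeWeight_ne_zero (T : CayleyTree k V) {θ : ℚ_[2]} (hθ : θ ≠ 0) (Λ : Finset V)
    (σ : V → Fin q) : edgeWeight T θ Λ σ ≠ 0 := by
  rw [edgeWeight, Finset.prod_ne_zero_iff]
  intro y _
  split_ifs
  exacts [hθ, one_ne_zero]

theorem pottsHamiltonian_eq [NeZero q] (T : CayleyTree k V) (J : ℚ_[2]) (n : ℕ) (s : T.ball n → Fin q) :
    open scoped Classical in pottsHamiltonian T J n s =
      ∑ y ∈ T.ball n,
        if y ≠ T.root ∧ extendConfig s y = extendConfig s (T.parent y) then J else 0 := by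
  classical
  have h := T.sum_edges_ball (K := ℚ_[2]) s
  rw [pottsHamiltonian]
  calc _ = J * _ := congrArg _ h
    _ = _ := by
      rw [Finset.mul_sum]
      exact Finset.sum_congr rfl fun y _ => by rw [mul_ite, mul_one, mul_zero]

theorem sum_sphere_eq [NeZero q] (T : CayleyTree k V) (h : Fin q → ℚ_[2]) (n : ℕ) (s : T.ball n → Fin q) :
    ∑ x ∈ T.sphere n, h (s x) = ∑ x ∈ T.level n, h (extendConfig s x) := by
  rw [CayleyTree.sphere, CayleyTree.level, Finset.sum_filter, Finset.sum_filter,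
    ← Finset.sum_coe_sort (T.ball n)]
  exact Finset.sum_congr rfl fun y _ => by rw [extendConfig_coe]

theorem pottsWeight_eq [NeZero q] (T : CayleyTree k V) {J : ℚ_[2]} (hJ : J ∈ expBall 2)
    {h : Fin q → ℚ_[2]} (hh : ∀ i, h i ∈ expBall 2) (n : ℕ) (s : T.ball n → Fin q) :
    pottsWeight T J (fun _ => h) n s =
      edgeWeight T (NormedSpace.exp J) (T.ball n) (extendConfig s) *
        ∏ x ∈ T.level n, NormedSpace.exp (h (extendConfig s x)) := by
  classical
  have hJ' (y : V) : (if y ≠ T.root ∧ extendConfig s y = extendConfig s (T.parent y)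
      then J else 0) ∈ expBall 2 := by
    split_ifs
    exacts [hJ, expBall_zero]
  rw [pottsWeight, sum_sphere_eq, pottsHamiltonian_eq,
    exp_add_of_mem_expBall (expBall_sum _ fun y _ => hJ' y) (expBall_sum _ fun y _ => hh _),
    exp_sum_of_mem_expBall _ fun y _ => hJ' y, exp_sum_of_mem_expBall _ fun y _ => hh _,
    edgeWeight]
  congr 1
  refine Finset.prod_congr rfl fun y _ => ?_
  rw [apply_ite NormedSpace.exp, NormedSpace.exp_zero]

-- The configurations extending s form a product set: one admissible spin at each vertex of the
-- ball, all spins on the new level. The weight is a product of one-vertex factors, so the sum of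
-- products is a product of sums.
open scoped Classical in
theorem sum_pottsWeight_fiber [NeZero q] (T : CayleyTree k V) {J : ℚ_[2]} (hJ : J ∈ expBall 2)
    {h : Fin q → ℚ_[2]} (hh : ∀ i, h i ∈ expBall 2) (n : ℕ) (s : T.ball n → Fin q) :
    ∑ t : T.ball (n + 1) → Fin q with
      Finset.restrict₂ (π := fun _ => Fin q) (T.ball_subset_succ n) t = s,
        pottsWeight T J (fun _ => h) (n + 1) t =
      edgeWeight T (NormedSpace.exp J) (T.ball n) (extendConfig s) *
        ∏ y ∈ T.level (n + 1), transfer (NormedSpace.exp J) (fun i => NormedSpace.exp (h i))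
          (extendConfig s (T.parent y)) := by
  set θ : ℚ_[2] := NormedSpace.exp J
  set σ := extendConfig s with hσ
  let F (y : V) (j : Fin q) : ℚ_[2] :=
    if y ∈ T.ball n then (if y ≠ T.root ∧ σ y = σ (T.parent y) then θ else 1)
    else (if j = σ (T.parent y) then θ else 1) * NormedSpace.exp (h j)
  let C (y : V) : Finset (Fin q) := if y ∈ T.ball n then {σ y} else Finset.univ
  have hfib : (Finset.univ.filter fun t : T.ball (n + 1) → Fin q =>
      Finset.restrict₂ (π := fun _ => Fin q) (T.ball_subset_succ n) t = s) =
      Fintype.piFinset fun y : T.ball (n + 1) => C y := by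
    ext t
    simp only [Finset.mem_filter, Finset.mem_univ, true_and, Fintype.mem_piFinset, C]
    constructor
    · rintro rfl y
      split_ifs with hy
      · rw [Finset.mem_singleton, hσ, extendConfig_of_mem _ hy]
        rfl
      · exact Finset.mem_univ _
    · intro ht
      funext x
      have := ht ⟨x, T.ball_subset_succ n x.2⟩
      rw [if_pos x.2, Finset.mem_singleton, hσ, extendConfig_coe] at this
      exact this
  have hw (t : T.ball (n + 1) → Fin q)
      (ht : t ∈ Fintype.piFinset fun y : T.ball (n + 1) => C y) :
      pottsWeight T J (fun _ => h) (n + 1) t = ∏ y : T.ball (n + 1), F y (t y) := by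
    have hag (x : V) (hx : x ∈ T.ball n) : extendConfig t x = σ x := by
      rw [← hfib, Finset.mem_filter] at ht
      rw [hσ, extendConfig_of_mem _ (T.ball_subset_succ n hx), ← ht.2, extendConfig_of_mem _ hx]
      rfl
    have e1 : ∏ y : T.ball (n + 1), F y (t y) = ∏ y ∈ T.ball (n + 1), F y (extendConfig t y) := by
      rw [← Finset.prod_coe_sort (T.ball (n + 1))]
      exact Finset.prod_congr rfl fun y _ => by rw [extendConfig_coe]
    have hsplit (f : V → ℚ_[2]) :
        ∏ y ∈ T.ball (n + 1), f y = (∏ y ∈ T.ball n, f y) * ∏ y ∈ T.level (n + 1), f y := by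
      rw [T.ball_succ, Finset.prod_union (T.disjoint_ball_level n)]
    rw [e1, pottsWeight_eq T hJ hh, edgeWeight, hsplit, hsplit, mul_assoc, ← Finset.prod_mul_distrib]
    congr 1
    · refine Finset.prod_congr rfl fun y hy => ?_
      simp only [F]
      rw [if_pos hy, hag y hy, hag _ (T.parent_mem_ball hy)]
    · refine Finset.prod_congr rfl fun y hy => ?_
      have hy' : y ∉ T.ball n := fun hb => Finset.disjoint_left.1 (T.disjoint_ball_level n) hb hy
      simp only [F]
      rw [if_neg hy', hag _ (T.level_subset_ball n (T.parent_mem_level hy))]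
      simp only [ne_eq, T.ne_root_of_mem_level hy, not_false_eq_true, true_and]
      rfl
  rw [hfib, Finset.sum_congr rfl hw, ← Finset.prod_univ_sum,
    Finset.prod_coe_sort (T.ball (n + 1)) fun y => ∑ j ∈ C y, F y j, T.ball_succ,
    Finset.prod_union (T.disjoint_ball_level n), edgeWeight]
  congr 1
  · refine Finset.prod_congr rfl fun y hy => ?_
    simp only [C, F, if_pos hy, Finset.sum_singleton]
  · refine Finset.prod_congr rfl fun y hy => ?_
    have hy' : y ∉ T.ball n := fun hb => Finset.disjoint_left.1 (T.disjoint_ball_level n) hb hy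
    simp only [C, F, if_neg hy', transfer]

-- Grouping the new vertices by parent gives exponent k. The inner ball starts at radius 1 because
-- the root has k + 1 children instead of k.
open scoped Classical in
theorem sum_pottsWeight_fiber_pow [NeZero q] (T : CayleyTree k V) {J : ℚ_[2]} (hJ : J ∈ expBall 2)
    {h : Fin q → ℚ_[2]} (hh : ∀ i, h i ∈ expBall 2) (n : ℕ) (s : T.ball (n + 1) → Fin q) :
    ∑ t : T.ball (n + 2) → Fin q with
      Finset.restrict₂ (π := fun _ => Fin q) (T.ball_subset_succ (n + 1)) t = s,
        pottsWeight T J (fun _ => h) (n + 2) t =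
      edgeWeight T (NormedSpace.exp J) (T.ball (n + 1)) (extendConfig s) *
        ∏ x ∈ T.level (n + 1), transfer (NormedSpace.exp J) (fun i => NormedSpace.exp (h i))
          (extendConfig s x) ^ k := by
  rw [sum_pottsWeight_fiber T hJ hh, ← Finset.prod_fiberwise_of_maps_to
    (s := T.level (n + 2)) (t := T.level (n + 1)) (g := T.parent) fun y hy => T.parent_mem_level hy]
  congr 1
  refine Finset.prod_congr rfl fun x hx => ?_
  rw [Finset.prod_congr rfl fun y hy => by rw [(Finset.mem_filter.1 hy).2], Finset.prod_const,
    T.card_children hx]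

open scoped Classical in
theorem pottsPartition_succ (T : CayleyTree k V) (J : ℚ_[2]) (h : Fin q → ℚ_[2]) (n : ℕ) :
    pottsPartition T J (fun _ => h) (n + 1) = ∑ s : T.ball n → Fin q,
      ∑ t : T.ball (n + 1) → Fin q with
        Finset.restrict₂ (π := fun _ => Fin q) (T.ball_subset_succ n) t = s,
          pottsWeight T J (fun _ => h) (n + 1) t := by
  rw [Finset.sum_fiberwise, pottsPartition]

theorem pottsPartition_one [NeZero q] (T : CayleyTree k V) {J : ℚ_[2]} (hJ : J ∈ expBall 2)
    {h : Fin q → ℚ_[2]} (hh : ∀ i, h i ∈ expBall 2) :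
    pottsPartition T J (fun _ => h) 1 =
      ∑ i, transfer (NormedSpace.exp J) (fun i => NormedSpace.exp (h i)) i ^ (k + 1) := by
  classical
  have hroot : T.root ∈ T.ball 0 := by simp [T.ball_zero]
  have : Unique (T.ball 0) :=
    { default := ⟨T.root, hroot⟩
      uniq := fun x => Subtype.ext (by simpa [T.ball_zero] using x.2) }
  rw [pottsPartition_succ T J h 0,
    ← Equiv.sum_comp (Equiv.funUnique (T.ball 0) (Fin q)).symm]
  refine Finset.sum_congr rfl fun i _ => ?_
  rw [sum_pottsWeight_fiber T hJ hh]
  have hpar {y : V} (hy : y ∈ T.level 1) : T.parent y = T.root := by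
    simpa [T.level_zero] using T.parent_mem_level hy
  have h1 : edgeWeight T (NormedSpace.exp J) (T.ball 0)
      (extendConfig ((Equiv.funUnique (T.ball 0) (Fin q)).symm i)) = 1 := by
    simp [edgeWeight, T.ball_zero]
  have hcard : (T.level (0 + 1)).card = k + 1 := by
    rw [← T.card_children_root, Finset.filter_true_of_mem fun y => hpar]
  rw [h1, one_mul, ← hcard]
  refine Finset.prod_eq_pow_card fun y hy => ?_
  rw [hpar hy, extendConfig_of_mem _ hroot]
  rfl

end Weights

/-! ### Existence and uniqueness of Gibbs measures for a translation-invariant field -/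

section GibbsMeasures

variable {k : ℕ} {V : Type*} {q : ℕ}

theorem exp_ne_zero_of_mem_expBall {x : ℚ_[2]} (hx : x ∈ expBall 2) :
    NormedSpace.exp x ≠ 0 := fun h => by
  have := norm_exp hx
  rw [h, norm_zero] at this
  exact zero_ne_one this

/-- These test configurations, spin i at one vertex and j at the N others, extract pointwise
identities from identities between products over the first level. -/
theorem exists_config_level_one [NeZero q] (T : CayleyTree k V) :
    ∃ N : ℕ, ∀ i j : Fin q, ∃ s : T.ball 1 → Fin q, ∀ f : Fin q → ℚ_[2],
      ∏ x ∈ T.level 1, f (extendConfig s x) = f i * f j ^ N := by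
  classical
  obtain ⟨x₀, hx₀⟩ := T.level_one_nonempty
  refine ⟨((T.level 1).erase x₀).card, fun i j => ⟨fun x => if x = x₀ then i else j, fun f => ?_⟩⟩
  rw [← Finset.mul_prod_erase _ _ hx₀, extendConfig_of_mem _ (T.level_subset_ball 1 hx₀), if_pos rfl]
  congr 1
  refine Finset.prod_eq_pow_card fun x hx => ?_
  obtain ⟨hne, hx⟩ := Finset.mem_erase.1 hx
  rw [extendConfig_of_mem _ (T.level_subset_ball 1 hx), if_neg hne]

theorem IsPottsGibbs.ext [NeZero q] {T : CayleyTree k V} {J : ℚ_[2]} {h : V → Fin q → ℚ_[2]}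
    {μ ν : PadicProbabilityMeasure 2 (cylinderAlgebra V q)} (hμ : IsPottsGibbs T J h μ)
    (hν : IsPottsGibbs T J h ν) : μ = ν :=
  cylinderMeasure_ext T.exists_subset_ball fun n s => by
    rw [(hμ.2 (n + 1) (by omega)).2, (hν.2 (n + 1) (by omega)).2]

/-- Only the compatibility of the marginals on the balls of radius 1 and 2 is needed. It equates two
products over the first level up to a constant; freezing all spins but one at 0 isolates the single
factors. -/
theorem IsPottsGibbs.exists_transfer_pow_eq [NeZero q] {T : CayleyTree k V} {J : ℚ_[2]}
    (hJ : J ∈ expBall 2) {h : Fin q → ℚ_[2]} (hh : ∀ i, h i ∈ expBall 2)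
    {μ : PadicProbabilityMeasure 2 (cylinderAlgebra V q)} (hμ : IsPottsGibbs T J (fun _ => h) μ) :
    ∃ κ : ℚ_[2], κ ≠ 0 ∧ ∀ i, transfer (NormedSpace.exp J) (fun i => NormedSpace.exp (h i)) i ^ k =
      κ * NormedSpace.exp (h i) := by
  classical
  obtain ⟨hZ1, h1⟩ := hμ.2 1 le_rfl
  obtain ⟨hZ2, h2⟩ := hμ.2 2 (by omega)
  set G := transfer (NormedSpace.exp J) fun i => NormedSpace.exp (h i)
  set r : ℚ_[2] := (pottsPartition T J (fun _ => h) 1)⁻¹ * pottsPartition T J (fun _ => h) 2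
  have hr : r ≠ 0 := mul_ne_zero (inv_ne_zero hZ1) hZ2
  have key (s : T.ball 1 → Fin q) :
      ∏ x ∈ T.level 1, G (extendConfig s x) ^ k =
        r * ∏ x ∈ T.level 1, NormedSpace.exp (h (extendConfig s x)) := by
    have e := toFun_cylinderSet_eq_sum (T.ball_subset_succ 1) μ s
    simp only [h1, h2] at e
    rw [← Finset.mul_sum, sum_pottsWeight_fiber_pow T hJ hh 0 s, pottsWeight_eq T hJ hh] at e
    have hE := edgeWeight_ne_zero T (exp_ne_zero_of_mem_expBall hJ) (T.ball 1) (extendConfig s)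
    apply mul_left_cancel₀ hE
    change _ * _ = _ * (_ * _ * _)
    linear_combination (-pottsPartition T J (fun _ => h) 2) * e -
      (edgeWeight T (NormedSpace.exp J) (T.ball 1) (extendConfig s) *
        ∏ x ∈ T.level 1, G (extendConfig s x) ^ k) * mul_inv_cancel₀ hZ2
  obtain ⟨N, hN⟩ := exists_config_level_one (q := q) T
  have hζ (i) : NormedSpace.exp (h i) ≠ 0 := exp_ne_zero_of_mem_expBall (hh i)
  have key2 (i j : Fin q) :
      G i ^ k * (G j ^ k) ^ N = r * (NormedSpace.exp (h i) * NormedSpace.exp (h j) ^ N) := by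
    obtain ⟨s, hs⟩ := hN i j
    have e := key s
    rw [hs fun i => G i ^ k, hs fun i => NormedSpace.exp (h i)] at e
    exact e
  have hG : (G 0 ^ k) ^ N ≠ 0 := fun h0 => by
    have e := key2 0 0
    rw [h0, mul_zero] at e
    exact mul_ne_zero hr (mul_ne_zero (hζ 0) (pow_ne_zero _ (hζ 0))) e.symm
  refine ⟨r * NormedSpace.exp (h 0) ^ N / (G 0 ^ k) ^ N,
    div_ne_zero (mul_ne_zero hr (pow_ne_zero _ (hζ 0))) hG, fun i => ?_⟩
  rw [div_mul_eq_mul_div, eq_div_iff hG, key2]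
  ring

theorem exists_isPottsGibbs [NeZero q] (T : CayleyTree k V) {J : ℚ_[2]} (hJ : J ∈ expBall 2)
    {h : Fin q → ℚ_[2]} (hh : ∀ i, h i ∈ expBall 2) {κ : ℚ_[2]} (hκ : κ ≠ 0)
    (htr : ∀ i, transfer (NormedSpace.exp J) (fun i => NormedSpace.exp (h i)) i ^ k =
      κ * NormedSpace.exp (h i))
    (hsum : ∑ i, transfer (NormedSpace.exp J) (fun i => NormedSpace.exp (h i)) i ^ (k + 1) ≠ 0) :
    ∃ μ : PadicProbabilityMeasure 2 (cylinderAlgebra V q), IsPottsGibbs T J (fun _ => h) μ := by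
  classical
  have hfib (n : ℕ) (s : T.ball (n + 1) → Fin q) :
      ∑ t : T.ball (n + 2) → Fin q with
        Finset.restrict₂ (π := fun _ => Fin q) (T.ball_subset_succ (n + 1)) t = s,
          pottsWeight T J (fun _ => h) (n + 2) t =
        κ ^ (T.level (n + 1)).card * pottsWeight T J (fun _ => h) (n + 1) s := by
    rw [sum_pottsWeight_fiber_pow T hJ hh, pottsWeight_eq T hJ hh]
    simp only [htr]
    rw [Finset.prod_mul_distrib, Finset.prod_const]
    ring
  have hZ (n : ℕ) : pottsPartition T J (fun _ => h) (n + 2) =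
      κ ^ (T.level (n + 1)).card * pottsPartition T J (fun _ => h) (n + 1) := by
    rw [pottsPartition_succ, Finset.sum_congr rfl fun s _ => hfib n s, ← Finset.mul_sum,
      pottsPartition]
  have hZ0 (n : ℕ) : pottsPartition T J (fun _ => h) (n + 1) ≠ 0 := by
    induction n with
    | zero => rwa [pottsPartition_one T hJ hh]
    | succ n ih => rw [hZ]; exact mul_ne_zero (pow_ne_zero _ hκ) ih
  obtain ⟨μ, hμ⟩ := exists_measure_of_consistent (p := 2) (q := q) (B := fun n => T.ball (n + 1))
    T.exists_subset_ball (fun n => T.ball_subset_succ (n + 1))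
    (fun n s => (pottsPartition T J (fun _ => h) (n + 1))⁻¹ * pottsWeight T J (fun _ => h) (n + 1) s)
    (by
      rw [← Finset.mul_sum]
      exact inv_mul_cancel₀ (hZ0 0))
    (fun n s => by
      rw [← Finset.mul_sum, hfib, hZ, mul_inv, mul_assoc,
        mul_left_comm _ (κ ^ (T.level (n + 1)).card), inv_mul_cancel_left₀ (pow_ne_zero _ hκ)])
  refine ⟨μ, fun _ i => hh i, fun n hn => ?_⟩
  obtain ⟨n, rfl⟩ : ∃ m, n = m + 1 := ⟨n - 1, by omega⟩
  exact ⟨hZ0 n, hμ n⟩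

theorem IsPottsGibbs.exp_mul_exp_eq [NeZero q] {T : CayleyTree k V} {J : ℚ_[2]} (hJ : J ∈ expBall 2)
    {h h' : Fin q → ℚ_[2]} (hh : ∀ i, h i ∈ expBall 2) (hh' : ∀ i, h' i ∈ expBall 2)
    {μ : PadicProbabilityMeasure 2 (cylinderAlgebra V q)} (hμ : IsPottsGibbs T J (fun _ => h) μ)
    (hμ' : IsPottsGibbs T J (fun _ => h') μ) (i j : Fin q) :
    NormedSpace.exp (h i) * NormedSpace.exp (h' j) =
      NormedSpace.exp (h j) * NormedSpace.exp (h' i) := by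
  obtain ⟨hZ, h1⟩ := hμ.2 1 le_rfl
  obtain ⟨hZ', h1'⟩ := hμ'.2 1 le_rfl
  obtain ⟨N, hN⟩ := exists_config_level_one (q := q) T
  have key (i j : Fin q) : (pottsPartition T J (fun _ => h) 1)⁻¹ *
      (NormedSpace.exp (h i) * NormedSpace.exp (h j) ^ N) =
      (pottsPartition T J (fun _ => h') 1)⁻¹ *
        (NormedSpace.exp (h' i) * NormedSpace.exp (h' j) ^ N) := by
    obtain ⟨s, hs⟩ := hN i j
    have e := (h1 s).symm.trans (h1' s)
    rw [pottsWeight_eq T hJ hh, pottsWeight_eq T hJ hh', hs fun i => NormedSpace.exp (h i),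
      hs fun i => NormedSpace.exp (h' i)] at e
    have hE := edgeWeight_ne_zero T (exp_ne_zero_of_mem_expBall hJ) (T.ball 1) (extendConfig s)
    apply mul_left_cancel₀ hE
    linear_combination e
  have hne : (pottsPartition T J (fun _ => h) 1)⁻¹ * NormedSpace.exp (h j) ^ N ≠ 0 :=
    mul_ne_zero (inv_ne_zero hZ) (pow_ne_zero _ (exp_ne_zero_of_mem_expBall (hh j)))
  -- Comparing the test configurations (i, j) and (j, j) eliminates both normalizing factors.
  apply mul_left_cancel₀ hne
  linear_combination NormedSpace.exp (h' j) * key i j - NormedSpace.exp (h' i) * key j j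

/-- The shift multiplies all weights on the ball of radius n by the same factor, which the
normalization cancels. -/
theorem IsPottsGibbs.add_const [NeZero q] {T : CayleyTree k V} {J : ℚ_[2]} (hJ : J ∈ expBall 2)
    {h : Fin q → ℚ_[2]} (hh : ∀ i, h i ∈ expBall 2)
    {μ : PadicProbabilityMeasure 2 (cylinderAlgebra V q)} (hμ : IsPottsGibbs T J (fun _ => h) μ)
    {c : ℚ_[2]} (hc : c ∈ expBall 2) : IsPottsGibbs T J (fun _ i => h i + c) μ := by
  have hh' (i) : h i + c ∈ expBall 2 := expBall_add (hh i) hc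
  have hw (n : ℕ) (s : T.ball n → Fin q) : pottsWeight T J (fun _ i => h i + c) n s =
      NormedSpace.exp c ^ (T.level n).card * pottsWeight T J (fun _ => h) n s := by
    rw [pottsWeight_eq T hJ hh, pottsWeight_eq T hJ hh',
      Finset.prod_congr rfl fun x _ => exp_add_of_mem_expBall (hh _) hc, Finset.prod_mul_distrib,
      Finset.prod_const]
    ring
  have hZ (n : ℕ) : pottsPartition T J (fun _ i => h i + c) n =
      NormedSpace.exp c ^ (T.level n).card * pottsPartition T J (fun _ => h) n := by
    rw [pottsPartition, pottsPartition, Finset.mul_sum]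
    exact Finset.sum_congr rfl fun s _ => hw n s
  refine ⟨fun _ => hh', fun n hn => ?_⟩
  obtain ⟨hZn, hn⟩ := hμ.2 n hn
  have hne := pow_ne_zero (T.level n).card (exp_ne_zero_of_mem_expBall hc)
  refine ⟨by rw [hZ]; exact mul_ne_zero hne hZn, fun s => ?_⟩
  rw [hn, hZ, hw, mul_inv, mul_assoc, mul_left_comm _ (NormedSpace.exp c ^ (T.level n).card),
    inv_mul_cancel_left₀ hne]

end GibbsMeasures

/-! ### Fields supported on a set of spins, and the roots of a quadratic equation -/

theorem norm_two_padic : ‖(2 : ℚ_[2])‖ = 1 / 2 := by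
  have := Padic.norm_p (p := 2)
  norm_num at this ⊢
  exact this

theorem norm_lt_one_iff_le_half {x : ℚ_[2]} : ‖x‖ < 1 ↔ ‖x‖ ≤ 1 / 2 := by
  have h := Padic.norm_le_pow_iff_norm_lt_pow_add_one x (-1)
  norm_num at h ⊢
  exact h.symm

/-- The residue field has two elements, so every unit is congruent to 1. -/
theorem norm_sub_one_lt_one {t : ℚ_[2]} (ht : ‖t‖ = 1) : ‖t - 1‖ < 1 := by
  obtain ⟨n, hn, hmem⟩ := PadicInt.exists_mem_range (p := 2) (x := ⟨t, ht.le⟩)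
  rw [IsLocalRing.mem_maximalIdeal, mem_nonunits_iff, PadicInt.not_isUnit_iff] at hmem
  have h : ‖t - (n : ℚ_[2])‖ < 1 := by
    rw [PadicInt.norm_def] at hmem
    exact hmem
  interval_cases n
  · simp [ht] at h
  · simpa using h

theorem norm_add_one_lt_one {t : ℚ_[2]} (ht : ‖t‖ = 1) : ‖t + 1‖ < 1 := by
  have h := norm_sub_one_lt_one (t := -t) (by rwa [norm_neg])
  rwa [← norm_neg, neg_sub, sub_neg_eq_add, add_comm] at h

/-- This puts the square of any unit into the image of the exponential, so unit roots need no
further condition. -/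
theorem norm_sq_sub_one_lt_half {t : ℚ_[2]} (ht : ‖t‖ = 1) : ‖t ^ 2 - 1‖ < 1 / 2 := by
  have h1 := norm_lt_one_iff_le_half.1 (norm_sub_one_lt_one ht)
  have h2 := norm_lt_one_iff_le_half.1 (norm_add_one_lt_one ht)
  have : t ^ 2 - 1 = (t - 1) * (t + 1) := by ring
  rw [this, norm_mul]
  nlinarith [norm_nonneg (t - 1), norm_nonneg (t + 1)]

/-- The roots `t` of the quadratic equation that is satisfied by the square roots `t` of the
values `exp c ≠ 1` for which the field `c • 1_M` defines a Gibbs measure. -/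
def nontrivialRoots (m q d : ℚ_[2]) : Set ℚ_[2] :=
  {t | ‖t‖ = 1 ∧ t ≠ 1 ∧ t ≠ -1 ∧ m * t ^ 2 - d * t + (q - m) = 0 ∧ m * t ^ 3 + (q - m) ≠ 0}

/-- If t and -t were both roots, subtracting the equations would give 2 d t = 0. Hence counting the
values exp c amounts to counting roots t. -/
theorem eq_of_sq_eq_of_mem_nontrivialRoots {m q d t t' : ℚ_[2]} (hd : d ≠ 0)
    (ht : t ∈ nontrivialRoots m q d) (ht' : t' ∈ nontrivialRoots m q d) (h : t ^ 2 = t' ^ 2) :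
    t = t' := by
  rcases sq_eq_sq_iff_eq_or_eq_neg.1 h with h | rfl
  · exact h
  have h0 : t' ≠ 0 := fun h0 => by simpa [h0] using ht'.1
  have e1 := ht.2.2.2.1
  have e2 := ht'.2.2.2.1
  have : 2 * (d * t') = 0 := by linear_combination e1 - e2
  simp [hd, h0] at this

section SpinSet

variable {k : ℕ} {V : Type*} {q : ℕ}

/-- The field `c • 1_M`. -/
noncomputable def spinField (M : Finset (Fin q)) (c : ℚ_[2]) (i : Fin q) : ℚ_[2] :=
  if i ∈ M then c else 0

theorem spinField_mem_expBall (M : Finset (Fin q)) {c : ℚ_[2]} (hc : c ∈ expBall 2) (i : Fin q) :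
    spinField M c i ∈ expBall 2 := by
  unfold spinField
  split_ifs
  exacts [hc, expBall_zero]

theorem exp_spinField (M : Finset (Fin q)) (c : ℚ_[2]) (i : Fin q) :
    NormedSpace.exp (spinField M c i) = if i ∈ M then NormedSpace.exp c else 1 := by
  rw [spinField, apply_ite NormedSpace.exp, NormedSpace.exp_zero]

theorem sum_ite_mem (M : Finset (Fin q)) (a b : ℚ_[2]) :
    ∑ i, (if i ∈ M then a else b) = M.card * a + (q - M.card) * b := by
  rw [Finset.sum_ite, Finset.sum_const, Finset.sum_const, Finset.filter_mem_eq_inter,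
    Finset.univ_inter, Finset.filter_not, Finset.filter_mem_eq_inter, Finset.univ_inter,
    ← Finset.compl_eq_univ_sdiff, Finset.card_compl, Fintype.card_fin, nsmul_eq_mul, nsmul_eq_mul,
    Nat.cast_sub ((Finset.card_le_univ M).trans_eq (Fintype.card_fin q))]

theorem transfer_spinField (θ : ℚ_[2]) (M : Finset (Fin q)) (c : ℚ_[2]) (i : Fin q) :
    transfer θ (fun i => NormedSpace.exp (spinField M c i)) i =
      M.card * NormedSpace.exp c + (q - M.card) +
        (θ - 1) * if i ∈ M then NormedSpace.exp c else 1 := by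
  have h (j : Fin q) : (if j = i then θ else 1) * NormedSpace.exp (spinField M c j) =
      (if j ∈ M then NormedSpace.exp c else 1) +
        if j = i then (θ - 1) * (if j ∈ M then NormedSpace.exp c else 1) else 0 := by
    rw [exp_spinField]
    split_ifs <;> ring
  rw [transfer, Finset.sum_congr rfl fun j _ => h j, Finset.sum_add_distrib, sum_ite_mem,
    Finset.sum_ite_eq' Finset.univ i, if_pos (Finset.mem_univ _), mul_one]

theorem exp_ne_one {c : ℚ_[2]} (hc : c ∈ expBall 2) (hc0 : c ≠ 0) : NormedSpace.exp c ≠ 1 :=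
  fun h => hc0 (exp_injOn_expBall hc expBall_zero (by rw [h, NormedSpace.exp_zero]))

/-- Dividing the transfer equation at a spin in M by the one at a spin outside M gives z = t² for t
= (S + d z) / (S + d). Then t (S + d) = S + d t² factors as (t - 1)(S - d t) = 0. The cubic
condition comes from the nonvanishing normalizing factor on the ball of radius 1. -/
theorem exists_root_of_isPottsGibbs {T : CayleyTree 2 V} {J : ℚ_[2]}
    (hJ : J ∈ expBall 2) {M : Finset (Fin q)} (hM : M.Nonempty) (hM' : M.card < q) {c : ℚ_[2]}
    (hc : c ∈ expBall 2) (hc0 : c ≠ 0) {μ : PadicProbabilityMeasure 2 (cylinderAlgebra V q)}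
    (hμ : IsPottsGibbs T J (fun _ => spinField M c) μ) :
    ∃ t ∈ nontrivialRoots M.card q (NormedSpace.exp J - 1), t ^ 2 = NormedSpace.exp c := by
  have : NeZero q := ⟨by omega⟩
  have hh := spinField_mem_expBall M hc
  obtain ⟨κ, hκ, htr⟩ := hμ.exists_transfer_pow_eq hJ hh
  have hsum := (hμ.2 1 le_rfl).1
  rw [pottsPartition_one T hJ hh] at hsum
  simp only [transfer_spinField] at htr hsum
  simp only [exp_spinField] at htr
  obtain ⟨i, hi⟩ := hM
  obtain ⟨j, hj⟩ : ∃ j, j ∉ M := by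
    by_contra! h
    rw [Finset.eq_univ_of_forall h, Finset.card_univ, Fintype.card_fin] at hM'
    omega
  have h1 := htr i
  have h2 := htr j
  rw [if_pos hi] at h1
  rw [if_neg hj] at h2
  have hz := norm_exp hc
  have hz1 := exp_ne_one hc hc0
  generalize NormedSpace.exp c = z at *
  generalize NormedSpace.exp J - 1 = d at *
  generalize hS : (M.card * z + (q - M.card) : ℚ_[2]) = S at *
  have hSd : S + d ≠ 0 := fun h0 => hκ (by
    rw [mul_one, mul_one, h0] at h2
    simpa using h2.symm)
  have ht2 : ((S + d * z) / (S + d)) ^ 2 = z := by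
    rw [div_pow, div_eq_iff (pow_ne_zero _ hSd), h1]
    linear_combination -z * h2
  have hmul : (S + d * z) / (S + d) * (S + d) = S + d * z := div_mul_cancel₀ _ hSd
  generalize (S + d * z) / (S + d) = t at *
  have hsum' : ∑ i, (S + d * if i ∈ M then z else 1) ^ (2 + 1) =
      (S + d) ^ 3 * (M.card * t ^ 3 + (q - M.card)) := by
    have : ∀ i, (S + d * if i ∈ M then z else 1) ^ (2 + 1) =
        if i ∈ M then (S + d * z) ^ 3 else (S + d) ^ 3 := fun i => by split_ifs <;> ring
    rw [Finset.sum_congr rfl fun i _ => this i, sum_ite_mem, ← hmul]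
    ring
  rw [hsum'] at hsum
  have ht1 : t ≠ 1 := by rintro rfl; exact hz1 (by rw [← ht2, one_pow])
  refine ⟨t, ⟨?_, ht1, ?_, ?_, right_ne_zero_of_mul hsum⟩, ht2⟩
  · rw [← ht2, norm_pow] at hz
    exact (pow_eq_one_iff_of_nonneg (norm_nonneg t) two_ne_zero).1 hz
  · rintro rfl
    exact hz1 (by rw [← ht2]; norm_num)
  · apply mul_left_cancel₀ (sub_ne_zero.2 ht1)
    subst hS
    subst ht2
    linear_combination hmul

theorem exists_isPottsGibbs_of_root (T : CayleyTree 2 V) {J : ℚ_[2]}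
    (hJ : J ∈ expBall 2) (hJ0 : J ≠ 0) (M : Finset (Fin q)) (hq : q ≠ 0) {t : ℚ_[2]}
    (ht : t ∈ nontrivialRoots M.card q (NormedSpace.exp J - 1)) :
    ∃ c ∈ expBall 2, c ≠ 0 ∧ NormedSpace.exp c = t ^ 2 ∧
      ∃ μ : PadicProbabilityMeasure 2 (cylinderAlgebra V q),
        IsPottsGibbs T J (fun _ => spinField M c) μ := by
  have : NeZero q := ⟨hq⟩
  obtain ⟨hnorm, ht1, ht1', hquad, hcub⟩ := ht
  obtain ⟨c, hc, hct⟩ := exists_exp_eq (norm_sq_sub_one_lt_half hnorm)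
  have hd := sub_ne_zero.2 (exp_ne_one hJ hJ0)
  have hSd : (NormedSpace.exp J - 1) * (t + 1) ≠ 0 :=
    mul_ne_zero hd fun h => ht1' (eq_neg_of_add_eq_zero_left h)
  -- The quadratic says S = d t, so the transfer takes the values d (t + 1) t on M and d (t + 1) off
  -- M; this dictates κ.
  refine ⟨c, hc, ?_, hct, exists_isPottsGibbs T hJ (spinField_mem_expBall M hc)
    (κ := ((NormedSpace.exp J - 1) * (t + 1)) ^ 2) (pow_ne_zero _ hSd) (fun i => ?_) ?_⟩
  · rintro rfl
    rw [NormedSpace.exp_zero] at hct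
    rcases sq_eq_sq_iff_eq_or_eq_neg.1 (hct.symm.trans (one_pow 2).symm) with h | h
    exacts [ht1 h, ht1' h]
  · rw [transfer_spinField, exp_spinField, hct]
    generalize NormedSpace.exp J - 1 = d at *
    have hS : (M.card * t ^ 2 + (q - M.card) : ℚ_[2]) = d * t := by linear_combination hquad
    rw [hS]
    split_ifs <;> ring
  · simp only [transfer_spinField, hct]
    generalize NormedSpace.exp J - 1 = d at *
    have hS : (M.card * t ^ 2 + (q - M.card) : ℚ_[2]) = d * t := by linear_combination hquad
    have : ∀ i, (M.card * t ^ 2 + (q - M.card) + d * if i ∈ M then t ^ 2 else 1) ^ (2 + 1) =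
        if i ∈ M then (d * (t + 1)) ^ 3 * t ^ 3 else (d * (t + 1)) ^ 3 := fun i => by
      rw [hS]; split_ifs <;> ring
    rw [Finset.sum_congr rfl fun i _ => this i, sum_ite_mem]
    have e : (M.card * ((d * (t + 1)) ^ 3 * t ^ 3) + (q - M.card) * (d * (t + 1)) ^ 3 : ℚ_[2]) =
        (d * (t + 1)) ^ 3 * (M.card * t ^ 3 + (q - M.card)) := by ring
    rw [e]
    exact mul_ne_zero (pow_ne_zero _ hSd) hcub

/-- The exponentials of the two fields are proportional. For M ≠ M', a spin outside M ∪ M' compared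
with one in M \ M' would force exp c = 1, so the two sets cover everything; spins of M \ M' and M' \
M then give the product relation. -/
theorem eq_or_exp_mul_exp_eq_one {T : CayleyTree k V} {J : ℚ_[2]} (hJ : J ∈ expBall 2)
    {M M' : Finset (Fin q)} (hcard : M.card = M'.card) (hM : M.Nonempty) (hM' : M.card < q)
    {c c' : ℚ_[2]} (hc : c ∈ expBall 2) (hc' : c' ∈ expBall 2) (hc0 : c ≠ 0)
    {μ : PadicProbabilityMeasure 2 (cylinderAlgebra V q)}
    (hμ : IsPottsGibbs T J (fun _ => spinField M c) μ)
    (hμ' : IsPottsGibbs T J (fun _ => spinField M' c') μ) :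
    M = M' ∧ c = c' ∨ q ≤ 2 * M.card ∧ NormedSpace.exp c * NormedSpace.exp c' = 1 := by
  have : NeZero q := ⟨by omega⟩
  have key := hμ.exp_mul_exp_eq hJ (spinField_mem_expBall M hc) (spinField_mem_expBall M' hc') hμ'
  simp only [exp_spinField] at key
  by_cases hMM : M = M'
  · subst hMM
    left
    obtain ⟨i, hi⟩ := hM
    obtain ⟨j, hj⟩ : ∃ j, j ∉ M := by
      by_contra! h
      rw [Finset.eq_univ_of_forall h, Finset.card_univ, Fintype.card_fin] at hM'
      omega
    have := key i j
    simp only [hi, hj, if_true, if_false, mul_one, one_mul] at this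
    exact ⟨rfl, exp_injOn_expBall hc hc' this⟩
  · right
    obtain ⟨i, hi, hi'⟩ : ∃ i ∈ M, i ∉ M' := by
      by_contra! h
      exact hMM (Finset.eq_of_subset_of_card_le h hcard.ge)
    obtain ⟨j, hj, hj'⟩ : ∃ j ∈ M', j ∉ M := by
      by_contra! h
      exact hMM (Finset.eq_of_subset_of_card_le h hcard.le).symm
    constructor
    · by_contra! hlt
      obtain ⟨l, hl⟩ : ∃ l, l ∉ M ∪ M' := by
        by_contra! h
        have h1 := Finset.card_union_le M M'
        rw [Finset.eq_univ_of_forall h, Finset.card_univ, Fintype.card_fin] at h1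
        omega
      rw [Finset.mem_union, not_or] at hl
      have := key i l
      simp only [hi, hi', hl, if_true, if_false, mul_one] at this
      exact exp_ne_one hc hc0 this
    · have := key i j
      simpa only [hi, hi', hj, hj', if_true, if_false, mul_one] using this

theorem tiGibbsMeasures_eq (T : CayleyTree 2 V) {J : ℚ_[2]} (m : ℕ) :
    tiGibbsMeasures T q J m = {μ | ∃ M : Finset (Fin q), M.card = m ∧ ∃ c : ℚ_[2], c ≠ 0 ∧
      IsPottsGibbs T J (fun _ => spinField M c) μ} :=
  rfl

theorem IsPottsGibbs.mem_expBall {T : CayleyTree k V} {J : ℚ_[2]} {M : Finset (Fin q)}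
    (hM : M.Nonempty) {c : ℚ_[2]} {μ : PadicProbabilityMeasure 2 (cylinderAlgebra V q)}
    (hμ : IsPottsGibbs T J (fun _ => spinField M c) μ) : c ∈ expBall 2 := by
  obtain ⟨i, hi⟩ := hM
  have := hμ.1 T.root i
  simpa only [spinField, if_pos hi] using this

theorem encard_setOf_card_eq (q m : ℕ) :
    {M : Finset (Fin q) | M.card = m}.encard = (q.choose m : ℕ) := by
  have : {M : Finset (Fin q) | M.card = m} =
      (Finset.powersetCard m (Finset.univ : Finset (Fin q)) : Set (Finset (Fin q))) := by
    ext M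
    simp
  rw [this, Set.encard_coe_eq_coe_finsetCard, Finset.card_powersetCard, Finset.card_univ,
    Fintype.card_fin]

theorem tiGibbsMeasures_eq_empty (T : CayleyTree 2 V) {J : ℚ_[2]} (hJ : J ∈ expBall 2) {m : ℕ}
    (hm : 1 ≤ m) (hmq : m < q) (hR : nontrivialRoots m q (NormedSpace.exp J - 1) = ∅) :
    tiGibbsMeasures T q J m = ∅ := by
  rw [Set.eq_empty_iff_forall_notMem, tiGibbsMeasures_eq]
  rintro μ ⟨M, rfl, c, hc0, hμ⟩
  have hM : M.Nonempty := Finset.card_pos.1 hm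
  obtain ⟨t, ht, -⟩ := exists_root_of_isPottsGibbs hJ hM hmq (hμ.mem_expBall hM) hc0 hμ
  exact Set.eq_empty_iff_forall_notMem.1 hR t ht

theorem encard_tiGibbsMeasures_of_ne (T : CayleyTree 2 V) {J : ℚ_[2]} (hJ : J ∈ expBall 2)
    (hJ0 : J ≠ 0) {m : ℕ} (hm : 1 ≤ m) (hmq : 2 * m < q) :
    (tiGibbsMeasures T q J m).encard =
      (q.choose m : ℕ) * (nontrivialRoots m q (NormedSpace.exp J - 1)).encard := by
  -- A root is needed to exhibit at least one measure, which `choose!` uses as a default value.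
  rcases (nontrivialRoots m q (NormedSpace.exp J - 1)).eq_empty_or_nonempty with hR | ⟨t₀, ht₀⟩
  · rw [tiGibbsMeasures_eq_empty T hJ hm (by omega) hR, hR]
    simp
  have hex (M : Finset (Fin q)) (t : ℚ_[2]) (hM : M.card = m)
      (ht : t ∈ nontrivialRoots m q (NormedSpace.exp J - 1)) :
      ∃ μ : PadicProbabilityMeasure 2 (cylinderAlgebra V q), ∃ c ∈ expBall 2, c ≠ 0 ∧
        NormedSpace.exp c = t ^ 2 ∧ IsPottsGibbs T J (fun _ => spinField M c) μ := by
    subst hM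
    obtain ⟨c, hc, hc0, hct, μ, hμ⟩ := exists_isPottsGibbs_of_root T hJ hJ0 M (by omega) ht
    exact ⟨μ, c, hc, hc0, hct, hμ⟩
  have : Nonempty (PadicProbabilityMeasure 2 (cylinderAlgebra V q)) := by
    obtain ⟨M, -, hM⟩ := Finset.exists_subset_card_eq (s := (Finset.univ : Finset (Fin q))) (n := m)
      (by rw [Finset.card_univ, Fintype.card_fin]; omega)
    exact ⟨(hex M t₀ hM ht₀).choose⟩
  choose! Φ hΦ using hex
  have himage : tiGibbsMeasures T q J m = (fun x : Finset (Fin q) × ℚ_[2] => Φ x.1 x.2) ''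
      ({M : Finset (Fin q) | M.card = m} ×ˢ nontrivialRoots m q (NormedSpace.exp J - 1)) := by
    rw [tiGibbsMeasures_eq]
    ext μ
    constructor
    · rintro ⟨M, rfl, c, hc0, hμ⟩
      have hM : M.Nonempty := Finset.card_pos.1 hm
      have hc := hμ.mem_expBall hM
      obtain ⟨t, ht, htc⟩ := exists_root_of_isPottsGibbs hJ hM (by omega) hc hc0 hμ
      obtain ⟨c', hc', -, hc't, hμ'⟩ := hΦ M t rfl ht
      obtain rfl := exp_injOn_expBall hc hc' (htc.symm.trans hc't.symm)
      have : NeZero q := ⟨by omega⟩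
      exact ⟨(M, t), ⟨rfl, ht⟩, hμ'.ext hμ⟩
    · rintro ⟨⟨M, t⟩, ⟨hM, ht⟩, rfl⟩
      obtain ⟨c, -, hc0, -, hμ⟩ := hΦ M t hM ht
      exact ⟨M, hM, c, hc0, hμ⟩
  rw [himage, Set.InjOn.encard_image, Set.encard_prod, encard_setOf_card_eq]
  rintro ⟨M, t⟩ ⟨hM, ht⟩ ⟨M', t'⟩ ⟨hM', ht'⟩ h
  simp only [Set.mem_ofPred_eq] at hM hM' ht ht' h
  obtain ⟨c, hc, hc0, hct, hμ⟩ := hΦ M t hM ht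
  obtain ⟨c', hc', -, hct', hμ'⟩ := hΦ M' t' hM' ht'
  rw [← h] at hμ'
  rcases eq_or_exp_mul_exp_eq_one hJ (hM.trans hM'.symm) (Finset.card_pos.1 (by omega)) (by omega)
    hc hc' hc0 hμ hμ' with ⟨rfl, rfl⟩ | ⟨h, -⟩
  · rw [eq_of_sq_eq_of_mem_nontrivialRoots (sub_ne_zero.2 (exp_ne_one hJ hJ0)) ht ht'
      (hct.symm.trans hct')]
  · omega

/-- A single root t already accounts for all measures: a field on M built from the other root 1/t
differs by a constant from the field on the complement built from t. -/
theorem encard_tiGibbsMeasures_of_eq (T : CayleyTree 2 V) {J : ℚ_[2]} (hJ : J ∈ expBall 2)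
    (hJ0 : J ≠ 0) {m : ℕ} (hm : 1 ≤ m) (hmq : q = 2 * m)
    (hR : (nontrivialRoots m q (NormedSpace.exp J - 1)).Nonempty) :
    (tiGibbsMeasures T q J m).encard = (q.choose m : ℕ) := by
  have : NeZero q := ⟨by omega⟩
  obtain ⟨t, ht⟩ := hR
  have hex (M : Finset (Fin q)) (hM : M.card = m) :
      ∃ μ : PadicProbabilityMeasure 2 (cylinderAlgebra V q), ∃ c ∈ expBall 2, c ≠ 0 ∧
        NormedSpace.exp c = t ^ 2 ∧ IsPottsGibbs T J (fun _ => spinField M c) μ := by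
    subst hM
    obtain ⟨c, hc, hc0, hct, μ, hμ⟩ := exists_isPottsGibbs_of_root T hJ hJ0 M (by omega) ht
    exact ⟨μ, c, hc, hc0, hct, hμ⟩
  have : Nonempty (PadicProbabilityMeasure 2 (cylinderAlgebra V q)) := by
    obtain ⟨M, -, hM⟩ := Finset.exists_subset_card_eq (s := (Finset.univ : Finset (Fin q))) (n := m)
      (by rw [Finset.card_univ, Fintype.card_fin]; omega)
    exact ⟨(hex M hM).choose⟩
  choose! Φ hΦ using hex
  have himage : tiGibbsMeasures T q J m = Φ '' {M : Finset (Fin q) | M.card = m} := by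
    rw [tiGibbsMeasures_eq]
    ext μ
    constructor
    · rintro ⟨M, rfl, c, hc0, hμ⟩
      have hM : M.Nonempty := Finset.card_pos.1 hm
      have hc := hμ.mem_expBall hM
      obtain ⟨t', ht', htc⟩ := exists_root_of_isPottsGibbs hJ hM (by omega) hc hc0 hμ
      by_cases htt : t' = t
      · subst htt
        obtain ⟨c', hc', -, hc't, hμ'⟩ := hΦ M rfl
        obtain rfl := exp_injOn_expBall hc hc' (htc.symm.trans hc't.symm)
        exact ⟨M, rfl, hμ'.ext hμ⟩
      · have hMc : Mᶜ.card = M.card := by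
          rw [Finset.card_compl, Fintype.card_fin]; omega
        obtain ⟨c', hc', -, hc't, hμ'⟩ := hΦ Mᶜ hMc
        have hm0 : (M.card : ℚ_[2]) ≠ 0 := by exact_mod_cast (by omega : M.card ≠ 0)
        have hqm : (q : ℚ_[2]) = 2 * (M.card : ℚ_[2]) := by exact_mod_cast hmq
        -- The product of the roots is (q - m) / m = 1.
        have hprod : t' * t = 1 := by
          have e1 := ht'.2.2.2.1
          have e2 := ht.2.2.2.1
          apply mul_left_cancel₀ hm0
          apply mul_left_cancel₀ (sub_ne_zero.2 htt)
          linear_combination t * e1 - t' * e2 - (t - t') * hqm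
        have hcc : -c = c' := by
          refine exp_injOn_expBall (expBall_neg hc) hc' ?_
          apply mul_left_cancel₀ (exp_ne_zero_of_mem_expBall hc)
          rw [← exp_add_of_mem_expBall hc (expBall_neg hc), add_neg_cancel, NormedSpace.exp_zero,
            hc't, ← htc, ← mul_pow, hprod, one_pow]
        have hshift := hμ.add_const hJ (spinField_mem_expBall M hc) (expBall_neg hc)
        have hfield : (fun i => spinField M c i + -c) = spinField Mᶜ c' := by
          funext i
          by_cases hi : i ∈ M <;> simp [spinField, ← hcc, hi]
        rw [hfield] at hshift
        exact ⟨Mᶜ, hMc, hμ'.ext hshift⟩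
    · rintro ⟨M, hM, rfl⟩
      obtain ⟨c, -, hc0, -, hμ⟩ := hΦ M hM
      exact ⟨M, hM, c, hc0, hμ⟩
  rw [himage, Set.InjOn.encard_image, encard_setOf_card_eq]
  intro M hM M' hM' h
  simp only [Set.mem_ofPred_eq] at hM hM'
  obtain ⟨c, hc, hc0, hct, hμ⟩ := hΦ M hM
  obtain ⟨c', hc', -, hct', hμ'⟩ := hΦ M' hM'
  obtain rfl := exp_injOn_expBall hc hc' (hct.trans hct'.symm)
  rw [← h] at hμ'
  rcases eq_or_exp_mul_exp_eq_one hJ (hM.trans hM'.symm) (Finset.card_pos.1 (by omega)) (by omega)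
    hc hc hc0 hμ hμ' with ⟨h, -⟩ | ⟨-, h⟩
  · exact h
  -- Different sets with the same c would force exp (2c) = 1, hence c = 0.
  · rw [← exp_add_of_mem_expBall hc hc] at h
    exact absurd h (exp_ne_one (expBall_add hc hc) (by rw [← two_mul]; simpa using hc0))

end SpinSet

/-! ### Counting the roots of the quadratic equation -/

theorem norm_add_eq_of_lt {x y : ℚ_[2]} (h : ‖y‖ < ‖x‖) : ‖x + y‖ = ‖x‖ := by
  rw [Padic.add_eq_max_of_ne h.ne', max_eq_left h.le]

theorem norm_sub_lt_of_norm_eq {x y : ℚ_[2]} (h : ‖x‖ = ‖y‖) (hy : y ≠ 0) : ‖x - y‖ < ‖y‖ := by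
  have hy' : 0 < ‖y‖ := norm_pos_iff.2 hy
  have h1 : ‖x / y‖ = 1 := by rw [norm_div, h, div_self hy'.ne']
  have e : x - y = (x / y - 1) * y := by field_simp
  rw [e, norm_mul]
  exact mul_lt_of_lt_one_left hy' (norm_sub_one_lt_one h1)

theorem norm_le_half_of_lt {x y : ℚ_[2]} (h : ‖x‖ < ‖y‖) : ‖x‖ ≤ ‖y‖ / 2 := by
  have hy : 0 < ‖y‖ := (norm_nonneg x).trans_lt h
  have h1 : ‖x / y‖ < 1 := by rw [norm_div, div_lt_one hy]; exact h
  have h2 := norm_lt_one_iff_le_half.1 h1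
  rw [norm_div, div_le_iff₀ hy] at h2
  linarith

theorem norm_four_mul (m : ℚ_[2]) : ‖4 * m‖ = ‖m‖ / 4 := by
  have : (4 : ℚ_[2]) * m = 2 * (2 * m) := by ring
  rw [this, norm_mul, norm_mul, norm_two_padic]
  ring

theorem norm_two_mul (m : ℚ_[2]) : ‖2 * m‖ = ‖m‖ / 2 := by
  rw [norm_mul, norm_two_padic]
  ring

/-- Hensel's lemma for a quadratic polynomial with a simple root modulo `2` at `0`. -/
theorem exists_root_quadratic {α β γ : ℚ_[2]} (hα : ‖α‖ ≤ 1) (hβ : ‖β‖ = 1) (hγ : ‖γ‖ < 1) :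
    ∃ w : ℚ_[2], ‖w‖ < 1 ∧ α * w ^ 2 + β * w + γ = 0 := by
  let a : ℤ_[2] := ⟨α, hα⟩
  let b : ℤ_[2] := ⟨β, hβ.le⟩
  let c : ℤ_[2] := ⟨γ, hγ.le⟩
  let F : Polynomial ℤ_[2] :=
    Polynomial.C a * Polynomial.X ^ 2 + Polynomial.C b * Polynomial.X + Polynomial.C c
  have hF (z : ℤ_[2]) : F.aeval z = a * z ^ 2 + b * z + c := by
    simp [F]
  have hF' : F.derivative.aeval (0 : ℤ_[2]) = b := by
    simp [F]
  have hb : ‖b‖ = 1 := hβ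
  obtain ⟨z, hz, hz', -⟩ := hensels_lemma (F := F) (a := 0) (by
    rw [hF, hF', hb]
    have : ‖c‖ < 1 := hγ
    simpa using this)
  rw [hF] at hz
  rw [hF', hb, sub_zero] at hz'
  refine ⟨z, hz', ?_⟩
  exact_mod_cast congrArg (Subtype.val : ℤ_[2] → ℚ_[2]) hz

section Roots

variable {m q d t t₁ t₂ : ℚ_[2]}

theorem eq_or_eq_of_root (hm : m ≠ 0) (hs : m * (t₁ + t₂) = d) (hp : m * (t₁ * t₂) = q - m)
    (ht : m * t ^ 2 - d * t + (q - m) = 0) : t = t₁ ∨ t = t₂ := by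
  have : m * ((t - t₁) * (t - t₂)) = 0 := by linear_combination ht - t * hs + hp
  rcases mul_eq_zero.1 ((mul_eq_zero.1 this).resolve_left hm) with h | h
  exacts [Or.inl (sub_eq_zero.1 h), Or.inr (sub_eq_zero.1 h)]

theorem root_ne_one (h : d ≠ q) (ht : m * t ^ 2 - d * t + (q - m) = 0) : t ≠ 1 := by
  rintro rfl
  exact h (by linear_combination -ht)

theorem root_ne_neg_one (h : d ≠ -q) (ht : m * t ^ 2 - d * t + (q - m) = 0) : t ≠ -1 := by
  rintro rfl
  exact h (by linear_combination ht)

theorem root_of_sum_prod (hs : m * (t₁ + t₂) = d) (hp : m * (t₁ * t₂) = q - m) :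
    m * t₁ ^ 2 - d * t₁ + (q - m) = 0 := by
  linear_combination t₁ * hs - hp

/-- A unit root can only exist in the following norm ranges. -/
theorem norm_of_unit_root (hm : m ≠ 0) (ht : ‖t‖ = 1)
    (hr : m * t ^ 2 - d * t + (q - m) = 0) : max ‖d‖ ‖q‖ < ‖4 * m‖ ∨ ‖d‖ = ‖q‖ := by
  by_contra! h
  obtain ⟨hmax, hne⟩ := h
  have hpos : 0 < ‖4 * m‖ := norm_pos_iff.2 (mul_ne_zero (by norm_num) hm)
  have h1 := norm_sq_sub_one_lt_half ht
  have h2 := norm_lt_one_iff_le_half.1 (norm_sub_one_lt_one ht)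
  -- If the norms of d and q differ, the left side has norm max ‖d‖ ‖q‖, while both terms on the
  -- right are strictly smaller.
  have e : q + -d = -(m * (t ^ 2 - 1)) + d * (t - 1) := by linear_combination hr
  have h3 : ‖q + -d‖ = max ‖d‖ ‖q‖ := by
    rw [Padic.add_eq_max_of_ne (by rw [norm_neg]; exact hne.symm), norm_neg, max_comm]
  have h4 : ‖q + -d‖ < max ‖d‖ ‖q‖ := by
    rw [e]
    refine (Padic.nonarchimedean _ _).trans_lt (max_lt ?_ ?_)
    · rw [norm_neg, norm_mul]
      rw [norm_four_mul] at hmax hpos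
      -- An odd square is 1 modulo 8: with u = (t - 1) / 2, t² - 1 = 4 u (u + 1), and u or u + 1 is
      -- even.
      have h5 : ‖t ^ 2 - 1‖ < 1 / 4 := by
        rcases lt_or_eq_of_le (norm_lt_half_iff.1 h1) with h | h
        · exact h
        exfalso
        have e3 : t ^ 2 - 1 = 2 * 2 * (((t - 1) / 2) * ((t - 1) / 2 + 1)) := by ring
        rw [e3, norm_mul, norm_mul, norm_two_padic] at h
        have h6 : ‖(t - 1) / 2‖ ≤ 1 := by
          rw [norm_div, norm_two_padic]; linarith
        rcases lt_or_eq_of_le h6 with h7 | h7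
        · rw [norm_mul, add_comm, norm_add_eq_of_lt (by rwa [norm_one]), norm_one] at h
          linarith
        · have := norm_add_one_lt_one h7
          rw [norm_mul, h7] at h
          linarith
      nlinarith
    · rw [norm_mul]
      have : 0 < max ‖d‖ ‖q‖ := hpos.trans_le hmax
      nlinarith [norm_nonneg d, le_max_left ‖d‖ ‖q‖]
  exact h4.ne h3

/-- Two distinct unit roots in the case of large `‖4 * m‖`. -/
theorem exists_unit_roots_of_norm_le (hm : m ≠ 0) (hd : ‖d‖ ≤ ‖4 * m‖) (hq : ‖q‖ ≤ ‖4 * m‖)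
    (hdq : ‖q - d‖ < ‖4 * m‖) : ∃ t₁ t₂ : ℚ_[2], t₁ ≠ t₂ ∧ ‖t₁‖ = 1 ∧ ‖t₂‖ = 1 ∧
      m * (t₁ + t₂) = d ∧ m * (t₁ * t₂) = q - m := by
  have hm' : 0 < ‖m‖ := norm_pos_iff.2 hm
  have h4 := norm_four_mul m
  -- Substituting t = 1 + 2w and dividing by 4m yields a monic quadratic with a simple root at 0
  -- modulo 2. The other root comes from Vieta.
  obtain ⟨w, hw, hroot⟩ := exists_root_quadratic (α := 1) (β := 1 + -(d / (2 * m)))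
    (γ := (q - d) / (4 * m)) norm_one.le (by
      rw [norm_add_eq_of_lt, norm_one]
      rw [norm_neg, norm_one, norm_div, norm_two_mul, div_lt_one (by positivity)]
      linarith) (by
      rw [norm_div, div_lt_one (by linarith)]
      exact hdq)
  have e1 : ‖1 + 2 * w‖ = 1 := by
    rw [norm_add_eq_of_lt, norm_one]
    rw [norm_one, norm_two_mul]
    linarith
  have hp : m * ((1 + 2 * w) * (d / m - (1 + 2 * w))) = q - m := by
    field_simp at hroot ⊢
    linear_combination (-1 / 2) * hroot
  refine ⟨1 + 2 * w, d / m - (1 + 2 * w), fun h => ?_, e1, ?_, ?_, hp⟩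
  · have h5 : 2 * (1 + 2 * w) = d / m := by linear_combination h
    have h6 : ‖d / m‖ ≤ 1 / 4 := by
      rw [norm_div, div_le_iff₀ hm']
      linarith
    rw [← h5, norm_two_mul, e1] at h6
    linarith
  · have h5 : ‖q - m‖ = ‖m‖ := by
      rw [← norm_neg, neg_sub, sub_eq_add_neg, norm_add_eq_of_lt]
      rw [norm_neg]
      linarith
    rw [← hp, norm_mul, norm_mul, e1, one_mul] at h5
    exact mul_left_cancel₀ hm'.ne' (h5.trans (mul_one _).symm)
  · field_simp
    ring

/-- Modulo 2 the expression is 1 + 1 + 1. Therefore units with equal cubes are equal, and at most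
one of two distinct unit roots makes the normalizing factor vanish. -/
theorem sq_add_mul_add_sq_ne_zero (h₁ : ‖t₁‖ = 1) (h₂ : ‖t₂‖ = 1) :
    t₁ ^ 2 + t₁ * t₂ + t₂ ^ 2 ≠ 0 := by
  intro h
  have e : (1 : ℚ_[2]) * (t₂ ^ 2) = -(t₁ * (t₁ + t₂)) := by linear_combination h
  have h3 := congrArg norm e
  rw [norm_neg, one_mul, norm_pow, h₂, norm_mul, h₁] at h3
  have h4 : ‖t₁ + t₂‖ < 1 := by
    have := norm_sub_lt_of_norm_eq (x := t₁) (y := -t₂) (by rw [norm_neg, h₁, h₂])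
      (neg_ne_zero.2 fun h0 => by simp [h0] at h₂)
    rwa [sub_neg_eq_add, norm_neg, h₂] at this
  linarith

/-- Essentially the resultant of the quadratic and the cubic; it is the source of
`DegeneratePartition`. -/
theorem cubic_mul_cubic (hs : m * (t₁ + t₂) = d) (hp : m * (t₁ * t₂) = q - m) :
    m * ((m * t₁ ^ 3 + (q - m)) * (m * t₂ ^ 3 + (q - m))) * m =
      (q - m) * (d ^ 3 + m * (q - m) * (q - 3 * d)) := by
  subst hs
  rw [← hp]
  have hq : q = m * (t₁ * t₂) + m := by linear_combination -hp
  subst hq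
  ring

theorem nontrivialRoots_eq (hm : m ≠ 0) (h₁ : ‖t₁‖ = 1) (h₂ : ‖t₂‖ = 1)
    (hs : m * (t₁ + t₂) = d) (hp : m * (t₁ * t₂) = q - m) :
    nontrivialRoots m q d =
      {t | (t = t₁ ∨ t = t₂) ∧ t ≠ 1 ∧ t ≠ -1 ∧ m * t ^ 3 + (q - m) ≠ 0} := by
  ext t
  constructor
  · rintro ⟨-, h1, h2, h3, h4⟩
    exact ⟨eq_or_eq_of_root hm hs hp h3, h1, h2, h4⟩
  · rintro ⟨h, h1, h2, h4⟩
    refine ⟨?_, h1, h2, ?_, h4⟩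
    · rcases h with rfl | rfl <;> assumption
    · rcases h with rfl | rfl
      · exact root_of_sum_prod hs hp
      · exact root_of_sum_prod (t₂ := t₁) (by rw [add_comm, hs]) (by rw [mul_comm t, hp])

theorem encard_nontrivialRoots_eq_two (hm : m ≠ 0) (hqm : q - m ≠ 0) (hne : t₁ ≠ t₂)
    (h₁ : ‖t₁‖ = 1) (h₂ : ‖t₂‖ = 1) (hs : m * (t₁ + t₂) = d) (hp : m * (t₁ * t₂) = q - m)
    (hdq : d ≠ q) (hdq' : d ≠ -q) (hdeg : d ^ 3 + m * (q - m) * (q - 3 * d) ≠ 0) :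
    (nontrivialRoots m q d).encard = 2 := by
  have hr₁ := root_of_sum_prod hs hp
  have hr₂ := root_of_sum_prod (t₁ := t₂) (t₂ := t₁) (by rw [add_comm, hs]) (by rw [mul_comm t₂, hp])
  have hcub : (m * t₁ ^ 3 + (q - m)) * (m * t₂ ^ 3 + (q - m)) ≠ 0 := fun h0 => by
    have := cubic_mul_cubic hs hp
    rw [h0, mul_zero, zero_mul] at this
    exact mul_ne_zero hqm hdeg this.symm
  have : nontrivialRoots m q d = {t₁, t₂} := by
    rw [nontrivialRoots_eq hm h₁ h₂ hs hp]
    ext t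
    constructor
    · exact fun h => h.1
    · rintro (rfl | rfl)
      · exact ⟨Or.inl rfl, root_ne_one hdq hr₁, root_ne_neg_one hdq' hr₁, left_ne_zero_of_mul hcub⟩
      · exact ⟨Or.inr rfl, root_ne_one hdq hr₂, root_ne_neg_one hdq' hr₂, right_ne_zero_of_mul hcub⟩
  rw [this, Set.encard_pair hne]

theorem encard_nontrivialRoots_eq_one (hm : m ≠ 0) (hne : t₁ ≠ t₂)
    (h₁ : ‖t₁‖ = 1) (h₂ : ‖t₂‖ = 1) (hs : m * (t₁ + t₂) = d) (hp : m * (t₁ * t₂) = q - m)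
    (hdq : d ≠ q) (hdq' : d ≠ -q) (hdeg : d ^ 3 + m * (q - m) * (q - 3 * d) = 0) :
    (nontrivialRoots m q d).encard = 1 := by
  have hcub : m * t₁ ^ 3 + (q - m) = 0 ∨ m * t₂ ^ 3 + (q - m) = 0 := by
    have := cubic_mul_cubic hs hp
    rw [hdeg, mul_zero] at this
    exact mul_eq_zero.1 ((mul_eq_zero.1 ((mul_eq_zero.1 this).resolve_right hm)).resolve_left hm)
  wlog h : m * t₁ ^ 3 + (q - m) = 0 generalizing t₁ t₂
  · exact this hne.symm h₂ h₁ (by rw [add_comm, hs]) (by rw [mul_comm t₂, hp]) hcub.symm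
      (hcub.resolve_left h)
  have hr₂ := root_of_sum_prod (t₁ := t₂) (t₂ := t₁) (by rw [add_comm, hs]) (by rw [mul_comm t₂, hp])
  have h' : m * t₂ ^ 3 + (q - m) ≠ 0 := fun h0 => by
    have : m * ((t₁ - t₂) * (t₁ ^ 2 + t₁ * t₂ + t₂ ^ 2)) = 0 := by linear_combination h - h0
    exact mul_ne_zero hm (mul_ne_zero (sub_ne_zero.2 hne) (sq_add_mul_add_sq_ne_zero h₁ h₂)) this
  have : nontrivialRoots m q d = {t₂} := by
    rw [nontrivialRoots_eq hm h₁ h₂ hs hp]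
    ext t
    constructor
    · rintro ⟨rfl | rfl, -, -, h0⟩
      exacts [absurd h h0, rfl]
    · rintro rfl
      exact ⟨Or.inr rfl, root_ne_one hdq hr₂, root_ne_neg_one hdq' hr₂, h'⟩
  rw [this, Set.encard_singleton]

/-- If `d = ± q` then one of the two roots is trivial. -/
theorem encard_nontrivialRoots_of_trivial_root (hm : m ≠ 0) (hq : q ≠ 0) (hqm : ‖q‖ < ‖m‖)
    (hne : q ≠ 2 * m) (hdq : d = q ∨ d = -q) : (nontrivialRoots m q d).encard = 1 := by
  have hm' : 0 < ‖m‖ := norm_pos_iff.2 hm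
  have hu : ‖(q - m) / m‖ = 1 := by
    rw [norm_div, ← norm_neg, neg_sub, sub_eq_add_neg, norm_add_eq_of_lt, div_self hm'.ne']
    rwa [norm_neg]
  obtain ⟨u, hu_def⟩ : ∃ u, u = (q - m) / m := ⟨_, rfl⟩
  rw [← hu_def] at hu
  have hu' : m * u = q - m := by rw [hu_def]; field_simp
  have hu1 : u ≠ 1 := by rintro rfl; exact hne (by linear_combination -hu')
  have hu2 : u ≠ -1 := by rintro rfl; exact hq (by linear_combination -hu')
  have hu0 : u ≠ 0 := by rintro rfl; simp at hu
  rcases hdq with rfl | rfl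
  · have : nontrivialRoots m d d = {u} := by
      rw [nontrivialRoots_eq (t₁ := 1) (t₂ := u) hm norm_one hu (by linear_combination hu')
        (by linear_combination hu')]
      ext t
      constructor
      · rintro ⟨rfl | rfl, h, -⟩
        exacts [absurd rfl h, rfl]
      · rintro rfl
        -- Here the cubic equals m u (u² + 1), and u² = -1 is impossible because u² - 1 would be -2,
        -- of norm exactly 1/2.
        refine ⟨Or.inr rfl, hu1, hu2, fun h0 => ?_⟩
        have h3 : m * t * (t ^ 2 + 1) = 0 := by linear_combination h0 + hu'
        have h4 := (mul_eq_zero.1 h3).resolve_left (mul_ne_zero hm hu0)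
        have h5 := norm_sq_sub_one_lt_half hu
        have h6 : t ^ 2 - 1 = -2 := by linear_combination h4
        rw [h6, norm_neg, norm_two_padic] at h5
        exact lt_irrefl _ h5
    rw [this, Set.encard_singleton]
  · have : nontrivialRoots m q (-q) = {-u} := by
      rw [nontrivialRoots_eq (t₁ := -1) (t₂ := -u) hm (by rw [norm_neg, norm_one])
        (by rw [norm_neg, hu]) (by linear_combination -hu') (by linear_combination hu')]
      ext t
      constructor
      · rintro ⟨rfl | rfl, -, h, -⟩
        exacts [absurd rfl h, rfl]
      · rintro rfl
        refine ⟨Or.inr rfl, fun h => hu2 (by rw [← h, neg_neg]), fun h => hu1 (neg_injective h),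
          fun h0 => ?_⟩
        have h3 : m * u * ((u - 1) * (u + 1)) = 0 := by linear_combination -h0 - hu'
        rcases mul_eq_zero.1 ((mul_eq_zero.1 h3).resolve_left (mul_ne_zero hm hu0)) with h | h
        exacts [hu1 (sub_eq_zero.1 h), hu2 (eq_neg_of_add_eq_zero_left h)]
    rw [this, Set.encard_singleton]

theorem nontrivialRoots_eq_empty_of_trivial_root (hqm : ‖m‖ ≤ ‖q‖) (hq : q ≠ 0)
    (hdq : d = q ∨ d = -q) : nontrivialRoots m q d = ∅ := by
  rw [Set.eq_empty_iff_forall_notMem]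
  rintro t ⟨ht, h1, h2, h3, -⟩
  have hq' : 0 < ‖q‖ := norm_pos_iff.2 hq
  have key {x : ℚ_[2]} (hx : ‖x‖ < 1) : ‖m * x‖ < ‖q‖ := by
    rw [norm_mul]
    nlinarith [norm_nonneg m, norm_nonneg x]
  rcases hdq with rfl | rfl
  · have h4 : (t - 1) * (m * (t + 1) - d) = 0 := by linear_combination h3
    have h5 := (mul_eq_zero.1 h4).resolve_left (sub_ne_zero.2 h1)
    have := key (norm_add_one_lt_one ht)
    rw [sub_eq_zero.1 h5] at this
    exact lt_irrefl _ this
  · have h4 : (t + 1) * (m * (t - 1) + q) = 0 := by linear_combination h3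
    have h5 := (mul_eq_zero.1 h4).resolve_left fun h => h2 (eq_neg_of_add_eq_zero_left h)
    have := key (norm_sub_one_lt_one ht)
    rw [eq_neg_of_add_eq_zero_left h5, norm_neg] at this
    exact lt_irrefl _ this

theorem encard_nontrivialRoots_of_norm_le (hd0 : d ≠ 0) (hmq : ‖m‖ ≤ ‖q‖) (hd : ‖d‖ = ‖q‖)
    (hdq : d ≠ q) (hdq' : d ≠ -q) : (nontrivialRoots m q d).encard = 1 := by
  have hd' : 0 < ‖d‖ := norm_pos_iff.2 hd0
  -- Substituting t = 1 + w and dividing by d gives a simple root at 0 modulo 2. A second unit root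
  -- t would satisfy m (t + u) = d, although t + u is not a unit.
  obtain ⟨w, hw, hroot⟩ := exists_root_quadratic (α := m / d) (β := -1 + 2 * (m / d))
    (γ := (q - d) / d) (by rw [norm_div, div_le_one hd', hd]; exact hmq) (by
      rw [norm_add_eq_of_lt, norm_neg, norm_one]
      rw [norm_neg, norm_one, norm_two_mul, norm_div, hd]
      have : ‖m‖ / ‖q‖ ≤ 1 := by rw [div_le_one (hd ▸ hd')]; exact hmq
      linarith) (by
      rw [norm_div, div_lt_one hd']
      exact norm_sub_lt_of_norm_eq hd.symm hd0)
  have hnorm : ‖1 + w‖ = 1 := by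
    rw [norm_add_eq_of_lt, norm_one]
    rwa [norm_one]
  have hr : m * (1 + w) ^ 2 - d * (1 + w) + (q - m) = 0 := by
    field_simp at hroot
    linear_combination hroot
  generalize 1 + w = u at hnorm hr
  have hu0 : u ≠ 0 := by rintro rfl; simp at hnorm
  have key {x : ℚ_[2]} (hx : ‖x‖ < 1) : ‖m * x‖ < ‖q‖ := by
    rw [norm_mul]
    nlinarith [norm_nonneg m, norm_nonneg x]
  have : nontrivialRoots m q d = {u} := by
    ext t
    constructor
    · rintro ⟨ht, -, -, h, -⟩
      by_contra hne
      have h1 : (t - u) * (m * (t + u) - d) = 0 := by linear_combination h - hr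
      have h2 := (mul_eq_zero.1 h1).resolve_left (sub_ne_zero.2 hne)
      have h3 : ‖t + u‖ < 1 := by
        have := norm_sub_lt_of_norm_eq (x := t) (y := -u) (by rw [norm_neg, ht, hnorm])
          (neg_ne_zero.2 hu0)
        rwa [sub_neg_eq_add, norm_neg, hnorm] at this
      have := key h3
      rw [sub_eq_zero.1 h2, hd] at this
      exact lt_irrefl _ this
    · rintro rfl
      refine ⟨hnorm, root_ne_one hdq hr, root_ne_neg_one hdq' hr, hr, fun h0 => ?_⟩
      have h1 : m * (t ^ 3 - 1) = -q := by linear_combination h0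
      have := key (norm_sub_one_lt_one (t := t ^ 3) (by rw [norm_pow, hnorm, one_pow]))
      rw [h1, norm_neg] at this
      exact lt_irrefl _ this
  rw [this, Set.encard_singleton]

/-- Strictly between ‖m‖/4 and ‖m‖ the norm can only be ‖m‖/2. -/
theorem norm_div_two_mul_eq_one {x : ℚ_[2]} (hm : m ≠ 0) (h1 : ‖x‖ < ‖m‖) (h2 : ‖4 * m‖ < ‖x‖) :
    ‖x / (2 * m)‖ = 1 := by
  have hm' : 0 < ‖m‖ := norm_pos_iff.2 hm
  have h3 := norm_le_half_of_lt h1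
  have h4 := norm_le_half_of_lt h2
  rw [norm_four_mul] at h4
  rw [norm_div, norm_two_mul, div_eq_one_iff_eq (by positivity)]
  linarith

/-- Completing the square when `‖4 * m‖ < ‖d‖ = ‖q‖ < ‖m‖`. -/
theorem exists_unit_roots_of_sq (hm : m ≠ 0) (hd : ‖d‖ = ‖q‖) (hqm : ‖q‖ < ‖m‖)
    (hmq : ‖4 * m‖ < ‖q‖) {s : ℚ_[2]} (hs : s ^ 2 = 1 - 2 * (q / (2 * m)) + (d / (2 * m)) ^ 2) :
    ‖d / (2 * m) + s‖ = 1 ∧ ‖d / (2 * m) - s‖ = 1 ∧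
      m * ((d / (2 * m) + s) + (d / (2 * m) - s)) = d ∧
      m * ((d / (2 * m) + s) * (d / (2 * m) - s)) = q - m := by
  have ha := norm_div_two_mul_eq_one hm hqm hmq
  have hb := norm_div_two_mul_eq_one (x := d) hm (by rwa [hd]) (by rwa [hd])
  have e1 : q = 2 * m * (q / (2 * m)) := by field_simp
  have e2 : d = 2 * m * (d / (2 * m)) := by field_simp
  generalize q / (2 * m) = a at *
  generalize d / (2 * m) = b at *
  have hprod : (b + s) * (b - s) = -1 + 2 * a := by linear_combination -hs
  have hn : ‖b + s‖ * ‖b - s‖ = 1 := by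
    rw [← norm_mul, hprod, norm_add_eq_of_lt, norm_neg, norm_one]
    rw [norm_neg, norm_one, norm_two_mul, ha]
    norm_num
  have hsum : ‖(b + s) + (b - s)‖ = 1 / 2 := by
    have : (b + s) + (b - s) = 2 * b := by ring
    rw [this, norm_two_mul, hb]
  -- The product of the roots has norm 1 and their sum norm 1/2. Unequal norms would make the larger
  -- one 1/2, too small for the product.
  have heq : ‖b + s‖ = ‖b - s‖ := by
    by_contra hne
    rw [Padic.add_eq_max_of_ne hne] at hsum
    have h1 := le_max_left ‖b + s‖ ‖b - s‖
    have h2 := le_max_right ‖b + s‖ ‖b - s‖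
    nlinarith [norm_nonneg (b + s), norm_nonneg (b - s)]
  have h1 : ‖b + s‖ = 1 := by
    rw [← heq] at hn
    nlinarith [norm_nonneg (b + s)]
  refine ⟨h1, heq ▸ h1, ?_, ?_⟩
  · linear_combination -e2
  · linear_combination m * hprod - e1

theorem sq_sub_eq_of_root (hm : m ≠ 0) (ht : m * t ^ 2 - d * t + (q - m) = 0) :
    (t - d / (2 * m)) ^ 2 = 1 - 2 * (q / (2 * m)) + (d / (2 * m)) ^ 2 := by
  field_simp
  linear_combination 4 * m * ht

theorem encard_nontrivialRoots_of_discrim_eq_zero (hm : m ≠ 0) (hd : ‖d‖ = ‖q‖) (hqm : ‖q‖ < ‖m‖)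
    (hmq : ‖4 * m‖ < ‖q‖) (hdq : d ≠ q) (hdq' : d ≠ -q)
    (hD : 1 - 2 * (q / (2 * m)) + (d / (2 * m)) ^ 2 = 0) : (nontrivialRoots m q d).encard = 1 := by
  obtain ⟨h1, -, h2, h3⟩ := exists_unit_roots_of_sq hm hd hqm hmq (s := 0) (by rw [hD]; norm_num)
  rw [add_zero] at h1 h2 h3
  rw [sub_zero] at h2 h3
  generalize d / (2 * m) = b at *
  have hr := root_of_sum_prod h2 h3
  have hb0 : b ≠ 0 := by rintro rfl; simp at h1
  have : nontrivialRoots m q d = {b} := by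
    rw [nontrivialRoots_eq hm h1 h1 h2 h3]
    ext t
    constructor
    · rintro ⟨rfl | rfl, -⟩ <;> rfl
    · rintro rfl
      refine ⟨Or.inl rfl, root_ne_one hdq hr, root_ne_neg_one hdq' hr, fun h0 => ?_⟩
      -- At a double root q - m = m t², so the cubic is m t² (t + 1).
      have h4 : m * t ^ 2 * (t + 1) = 0 := by linear_combination h0 + h3
      have h5 := (mul_eq_zero.1 h4).resolve_left (mul_ne_zero hm (pow_ne_zero _ hb0))
      exact root_ne_neg_one hdq' hr (eq_neg_of_add_eq_zero_left h5)
  rw [this, Set.encard_singleton]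

theorem nontrivialRoots_nonempty_of_eq_two_mul (hm : m ≠ 0) (hd : ‖d‖ = ‖q‖) (hqm : ‖q‖ < ‖m‖)
    (hmq : ‖4 * m‖ < ‖q‖) (hdq : d ≠ q) (hdq' : d ≠ -q) (hq : q = 2 * m) {s : ℚ_[2]}
    (hs : s ^ 2 = (d / q) ^ 2 - 1) : (nontrivialRoots m q d).Nonempty := by
  obtain ⟨h1, h1', h2, h3⟩ := exists_unit_roots_of_sq hm hd hqm hmq (s := s) (by
    rw [← hq, hs, div_self (by rw [hq]; exact mul_ne_zero two_ne_zero hm)]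
    ring)
  generalize d / (2 * m) + s = u at *
  generalize d / (2 * m) - s = u' at *
  have hr := root_of_sum_prod h2 h3
  have hu := root_ne_neg_one hdq' hr
  refine ⟨u, h1, root_ne_one hdq hr, hu, hr, fun h0 => ?_⟩
  have h4 : m * ((u + 1) * (u ^ 2 + u * (-1) + (-1) ^ 2)) = 0 := by linear_combination h0 - hq
  exact mul_ne_zero hm (mul_ne_zero (fun h => hu (eq_neg_of_add_eq_zero_left h))
    (sq_add_mul_add_sq_ne_zero h1 (by rw [norm_neg, norm_one]))) h4

theorem nontrivialRoots_eq_empty_of_eq_two_mul (hm : m ≠ 0) (hq : q = 2 * m)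
    (hdq : d = q ∨ d = -q) : nontrivialRoots m q d = ∅ := by
  rw [Set.eq_empty_iff_forall_notMem]
  rintro t ⟨-, h1, h2, h3, -⟩
  rcases hdq with rfl | rfl
  · have : m * (t - 1) ^ 2 = 0 := by rw [hq] at h3; linear_combination h3
    exact mul_ne_zero hm (pow_ne_zero _ (sub_ne_zero.2 h1)) this
  · have : m * (t + 1) ^ 2 = 0 := by rw [hq] at h3; linear_combination h3
    exact mul_ne_zero hm (pow_ne_zero _ fun h => h2 (eq_neg_of_add_eq_zero_left h)) this

end Roots

/-! ### The number of translation-invariant Gibbs measures -/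

section Cases

variable {q m : ℕ} {θ : ℚ_[2]}

theorem ne_neg_of_ne_one_sub (h : θ ≠ 1 - q) : θ - 1 ≠ -(q : ℚ_[2]) :=
  fun e => h (by linear_combination e)

theorem ne_of_ne_one_add (h : θ ≠ 1 + q) : θ - 1 ≠ (q : ℚ_[2]) :=
  fun e => h (by linear_combination e)

theorem eq_or_eq_neg_of_trivial (h : θ = 1 - q ∨ θ = 1 + q) :
    θ - 1 = (q : ℚ_[2]) ∨ θ - 1 = -(q : ℚ_[2]) := by
  rcases h with h | h
  · right; linear_combination h
  · left; linear_combination h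

theorem CaseOne.exists_roots (hm : m ≠ 0) (hq : q ≠ 0) (h : CaseOne q m θ) :
    q ≠ 2 * m ∧ θ - 1 ≠ (q : ℚ_[2]) ∧ θ - 1 ≠ -(q : ℚ_[2]) ∧
      ∃ t₁ t₂ : ℚ_[2], t₁ ≠ t₂ ∧ ‖t₁‖ = 1 ∧ ‖t₂‖ = 1 ∧
        m * (t₁ + t₂) = θ - 1 ∧ m * (t₁ * t₂) = q - m := by
  have hm0 : (m : ℚ_[2]) ≠ 0 := by exact_mod_cast hm
  have hq0 : (q : ℚ_[2]) ≠ 0 := by exact_mod_cast hq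
  have hm' : 0 < ‖(m : ℚ_[2])‖ := norm_pos_iff.2 hm0
  have hne (h : ‖(q : ℚ_[2])‖ ≤ ‖(4 * m : ℚ_[2])‖) : q ≠ 2 * m := by
    rintro rfl
    push_cast at h
    rw [norm_four_mul, norm_two_mul] at h
    linarith
  rcases h with ⟨h1, h2, h3⟩ | ⟨h1, h2, h3, h4⟩ | ⟨h1, h2, h3, h4, h5, h6, s, hs0, hs⟩
  · obtain ⟨hd, hq⟩ := max_lt_iff.1 h1
    refine ⟨hne hq.le, ne_of_ne_one_add h3, ne_neg_of_ne_one_sub h2,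
      exists_unit_roots_of_norm_le hm0 hd.le hq.le ?_⟩
    rw [sub_eq_add_neg]
    exact (Padic.nonarchimedean _ _).trans_lt (max_lt hq (by rwa [norm_neg]))
  · refine ⟨hne (by rw [h1, h2]), ne_of_ne_one_add h4, ne_neg_of_ne_one_sub h3,
      exists_unit_roots_of_norm_le hm0 h1.ge (by rw [h1, h2]) ?_⟩
    rw [h1]
    exact norm_sub_lt_of_norm_eq h2.symm fun h0 => hq0 (norm_eq_zero.1 (by rw [← h2, h0, norm_zero]))
  · obtain ⟨h7, h8, h9, h10⟩ := exists_unit_roots_of_sq hm0 h2 (h2 ▸ h1) h3 hs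
    refine ⟨h4, ne_of_ne_one_add h6, ne_neg_of_ne_one_sub h5, _, _, fun h => hs0 ?_, h7, h8, h9, h10⟩
    have : 2 * s = 0 := by linear_combination h
    simpa using this

theorem CaseTwo.encard_roots (hm : m ≠ 0) (hq : q ≠ 0) (hθ : θ ≠ 1) (h : CaseTwo q m θ) :
    q ≠ 2 * m ∧ (nontrivialRoots m q (θ - 1)).encard = 1 ∨
      q = 2 * m ∧ (nontrivialRoots m q (θ - 1)).Nonempty := by
  have hm0 : (m : ℚ_[2]) ≠ 0 := by exact_mod_cast hm
  have hq0 : (q : ℚ_[2]) ≠ 0 := by exact_mod_cast hq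
  have hd0 : θ - 1 ≠ 0 := sub_ne_zero.2 hθ
  have hm' : 0 < ‖(m : ℚ_[2])‖ := norm_pos_iff.2 hm0
  have hcast : (q : ℚ_[2]) = 2 * m ↔ q = 2 * m := by norm_cast
  have hfour := norm_four_mul (m : ℚ_[2])
  have hne (h : ‖(q : ℚ_[2])‖ ≠ ‖(m : ℚ_[2])‖ / 2) : q ≠ 2 * m := by
    rintro rfl
    push_cast at h
    exact h (norm_two_mul _)
  rcases h with ⟨h1, h2⟩ | ⟨h1, h2, h3⟩ | ⟨h1, h2, h3, h4, h5⟩ | ⟨h1, h2, h3, h4, h5⟩ |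
    ⟨h1, h2, h3, h4⟩ | ⟨h1, h2, h3, h4, h5, h6, s, hs⟩ | ⟨h1, h2, h3, h4, h5, h6⟩
  · obtain ⟨-, hq⟩ := max_lt_iff.1 h1
    have hqm := hne (by linarith)
    exact Or.inl ⟨hqm, encard_nontrivialRoots_of_trivial_root hm0 hq0 (by linarith)
      (mt hcast.1 hqm) (eq_or_eq_neg_of_trivial h2)⟩
  · have hqm := hne (by linarith)
    exact Or.inl ⟨hqm, encard_nontrivialRoots_of_trivial_root hm0 hq0 (by linarith)
      (mt hcast.1 hqm) (eq_or_eq_neg_of_trivial h3)⟩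
  · exact Or.inl ⟨hne (by linarith), encard_nontrivialRoots_of_norm_le hd0 (by linarith) h2
      (ne_of_ne_one_add h5) (ne_neg_of_ne_one_sub h4)⟩
  · exact Or.inl ⟨h4, encard_nontrivialRoots_of_trivial_root hm0 hq0 (by linarith)
      (mt hcast.1 h4) (eq_or_eq_neg_of_trivial h5)⟩
  · exact Or.inl ⟨hne (by linarith), encard_nontrivialRoots_of_norm_le hd0 h2.le h1
      (ne_of_ne_one_add h4) (ne_neg_of_ne_one_sub h3)⟩
  · exact Or.inr ⟨h4, nontrivialRoots_nonempty_of_eq_two_mul hm0 h2 (by linarith) h3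
      (ne_of_ne_one_add h6) (ne_neg_of_ne_one_sub h5) (hcast.2 h4) hs⟩
  · left
    refine ⟨fun hqm => ?_, encard_nontrivialRoots_of_discrim_eq_zero hm0 h2 (by linarith) h3
      (ne_of_ne_one_add h5) (ne_neg_of_ne_one_sub h4) h6⟩
    -- For q = 2m a vanishing discriminant means d = ± q, which is excluded.
    rw [← hcast.2 hqm, div_self hq0] at h6
    have h7 : ((θ - 1) / q) ^ 2 = 1 ^ 2 := by linear_combination h6
    rcases sq_eq_sq_iff_eq_or_eq_neg.1 h7 with h8 | h8 <;> rw [div_eq_iff hq0] at h8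
    · exact ne_of_ne_one_add h5 (by rw [h8, one_mul])
    · exact ne_neg_of_ne_one_sub h4 (by rw [h8, neg_one_mul])

/-- This gives exhaustiveness of the case list: one nontrivial root already pins down the norms, and
`sq_sub_eq_of_root` supplies the required square root t - d / (2m). -/
theorem caseOne_or_caseTwo_of_mem (hm : m ≠ 0) (hq : q ≠ 0) {t : ℚ_[2]}
    (ht : t ∈ nontrivialRoots m q (θ - 1)) : CaseOne q m θ ∨ CaseTwo q m θ := by
  have hm0 : (m : ℚ_[2]) ≠ 0 := by exact_mod_cast hm
  have hq0 : (q : ℚ_[2]) ≠ 0 := by exact_mod_cast hq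
  have hcast : (q : ℚ_[2]) = 2 * m ↔ q = 2 * m := by norm_cast
  by_cases htriv : θ = 1 - q ∨ θ = 1 + q
  · have htriv' := eq_or_eq_neg_of_trivial htriv
    have hlt : ‖(q : ℚ_[2])‖ < ‖(m : ℚ_[2])‖ := by
      by_contra! h
      rw [nontrivialRoots_eq_empty_of_trivial_root h hq0 htriv'] at ht
      exact ht
    have hne : q ≠ 2 * m := fun h => by
      rw [nontrivialRoots_eq_empty_of_eq_two_mul hm0 (hcast.2 h) htriv'] at ht
      exact ht
    have hd : ‖θ - 1‖ = ‖(q : ℚ_[2])‖ := by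
      rcases htriv' with h | h <;> rw [h]
      rw [norm_neg]
    right
    rcases lt_trichotomy ‖(q : ℚ_[2])‖ ‖(4 * m : ℚ_[2])‖ with h | h | h
    · exact Or.inl ⟨by rwa [hd, max_self], htriv⟩
    · exact Or.inr (Or.inl ⟨by rw [hd, h], hd, htriv⟩)
    · exact Or.inr (Or.inr (Or.inr (Or.inl ⟨by rwa [hd], hd, h, hne, htriv⟩)))
  · obtain ⟨h1, h2⟩ := not_or.1 htriv
    rcases norm_of_unit_root hm0 ht.1 ht.2.2.2.1 with hmax | hd
    · exact Or.inl (Or.inl ⟨hmax, h1, h2⟩)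
    rcases lt_trichotomy ‖(q : ℚ_[2])‖ ‖(4 * m : ℚ_[2])‖ with h | h | h
    · exact Or.inl (Or.inl ⟨by rwa [hd, max_self], h1, h2⟩)
    · exact Or.inl (Or.inr (Or.inl ⟨by rw [hd, h], hd, h1, h2⟩))
    rcases lt_trichotomy ‖(m : ℚ_[2])‖ ‖(q : ℚ_[2])‖ with h3 | h3 | h3
    · exact Or.inr (Or.inr (Or.inr (Or.inr (Or.inr (Or.inl ⟨hd, h3, h1, h2⟩)))))
    · exact Or.inr (Or.inr (Or.inr (Or.inl ⟨by rw [h3, hd], hd, h, h1, h2⟩)))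
    have hs := sq_sub_eq_of_root hm0 ht.2.2.2.1
    by_cases hqm : q = 2 * m
    · refine Or.inr (Or.inr (Or.inr (Or.inr (Or.inr (Or.inr (Or.inl
        ⟨by rwa [hd], hd, h, hqm, h1, h2, _, hs.trans ?_⟩))))))
      rw [← hcast.2 hqm, div_self hq0]
      ring
    · by_cases hs0 : t - (θ - 1) / (2 * m) = 0
      · refine Or.inr (Or.inr (Or.inr (Or.inr (Or.inr (Or.inr (Or.inr
          ⟨by rwa [hd], hd, h, h1, h2, hs.symm.trans ?_⟩))))))
        rw [hs0]
        ring
      · exact Or.inl (Or.inr (Or.inr ⟨by rwa [hd], hd, h, hqm, h1, h2, _, hs0, hs⟩))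

end Cases

theorem theorem4 {V : Type*} (T : CayleyTree 2 V) (q m : ℕ) (hm : 1 ≤ m) (hmq : m ≤ q / 2)
    (J : ℚ_[2]) (hJ : J ∈ expBall 2) (hJ0 : J ≠ 0) (θ : ℚ_[2]) (hθ : θ = NormedSpace.exp J) :
    (CaseOne q m θ → ¬ DegeneratePartition q m θ →
      (tiGibbsMeasures T q J m).encard = ((2 * q.choose m : ℕ) : ℕ∞)) ∧
    (CaseTwo q m θ ∨ (CaseOne q m θ ∧ DegeneratePartition q m θ) →
      (tiGibbsMeasures T q J m).encard = ((q.choose m : ℕ) : ℕ∞)) ∧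
    (¬ CaseOne q m θ → ¬ CaseTwo q m θ → tiGibbsMeasures T q J m = ∅) := by
  have hm0 : m ≠ 0 := by omega
  have hq0 : q ≠ 0 := by omega
  have hmc : (m : ℚ_[2]) ≠ 0 := by exact_mod_cast hm0
  have hqm : (q : ℚ_[2]) - m ≠ 0 := sub_ne_zero.2 (by exact_mod_cast (by omega : q ≠ m))
  have hθ1 : θ ≠ 1 := hθ ▸ exp_ne_one hJ hJ0
  have hcount (hne : q ≠ 2 * m) := encard_tiGibbsMeasures_of_ne T hJ hJ0 hm (q := q) (by omega)
  rw [← hθ] at hcount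
  refine ⟨fun h1 hdeg => ?_, ?_, fun h1 h2 => ?_⟩
  · obtain ⟨hne, hdq, hdq', t₁, t₂, ht, hn₁, hn₂, hs, hp⟩ := h1.exists_roots hm0 hq0
    rw [hcount hne, encard_nontrivialRoots_eq_two hmc hqm ht hn₁ hn₂ hs hp hdq hdq' hdeg]
    push_cast
    rw [mul_comm]
  · rintro (h2 | ⟨h1, hdeg⟩)
    · rcases h2.encard_roots hm0 hq0 hθ1 with ⟨hne, hR⟩ | ⟨heq, hR⟩
      · rw [hcount hne, hR, mul_one]
      · exact encard_tiGibbsMeasures_of_eq T hJ hJ0 hm heq (hθ ▸ hR)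
    · obtain ⟨hne, hdq, hdq', t₁, t₂, ht, hn₁, hn₂, hs, hp⟩ := h1.exists_roots hm0 hq0
      rw [hcount hne, encard_nontrivialRoots_eq_one hmc ht hn₁ hn₂ hs hp hdq hdq' hdeg, mul_one]
  · refine tiGibbsMeasures_eq_empty T hJ hm (by omega) (Set.eq_empty_iff_forall_notMem.2 ?_)
    rw [← hθ]
    intro t ht
    exact (caseOne_or_caseTwo_of_mem hm0 hq0 ht).elim h1 h2
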